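/- Let $d,s\ge 1$ and let $\mathbb{Z}^d\times\mathbb{Z}^s=\mathbb{Z}^{d+s}$ be the nearest-neighbour lattice. A $\mathbb{Z}^d$-edge (respectively $\mathbb{Z}^s$-edge) is an edge whose endpoints differ only in their $\mathbb{Z}^d$-component (respectively $\mathbb{Z}^s$-component). For $p,q\in[0,1]$ let $\mathbb{P}_{p,q}$ be the bond percolation measure under which all edges are independent, each $\mathbb{Z}^d$-edge is open with probability $p$ and each $\mathbb{Z}^s$-edge is open with probability $q$. Let $\theta(p,q)$ be the $\mathbb{P}_{p,q}$-probability that the open cluster of the origin is infinite, and let $q_c(p)=\sup\{q\in[0,1]:\theta(p,q)=0\}$. Let $p_c(d)=\sup\{p\in[0,1]:\theta_d(p)=0\}$ be the critical threshold of homogeneous bond percolation on $\mathbb{Z}^d$, where $\theta_d(p)$ is the probability that the open cluster of the origin is infinite when every edge of $\mathbb{Z}^d$ is open independently with probability $p$. **Theorem.** For every $d\ge1$ there is $\varepsilon=\varepsilon(d)>0$ such that for all $s\ge1$ and all $p\in[0,1]$ with $0<p_c(d)-p<\varepsilon$: 1. for every $q\in[0,1]$ with $q\ge 8d^2\,(p_c(d)-p)$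 there is $\mathbb{P}_{p,q}$-almost surely an infinite open cluster; 2. $q_c(p)\le 8d^2\,(p_c(d)-p)$. Consequently, for all $d,s\ge1$, if $\psi\in\mathbb{R}$ is a crossover exponent, that is, if $$\lim_{p\uparrow p_c(d)}\frac{\log q_c(p)}{\log\left(|p-p_c(d)|^{\psi}\right)}=1,$$ then $\psi\ge1$. -/

import Mathlib

open MeasureTheory ProbabilityTheory Filter Topology
open scoped ENNReal

noncomputable section

namespace Percolation

/-- The nearest-neighbour graph on `ℤ^n`: two vertices are adjacent iff their `ℓ¹`-distance
is `1`. -/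
def lattice (n : ℕ) : SimpleGraph (Fin n → ℤ) where
  Adj x y := ∑ i, |x i - y i| = 1
  symm := ⟨fun x y h => by simpa only [abs_sub_comm] using h⟩
  loopless := ⟨fun x h => by simp at h⟩

section General

variable {V : Type*} {G : SimpleGraph V}

/-- Bond configurations on a graph: each edge is open (`true`) or closed (`false`). The measurable
structure is the product one, generated by the cylinder sets. -/
abbrev Config (G : SimpleGraph V) : Type _ := G.edgeSet → Bool

/-- Independent bond percolation: the product over all edges `e` of the Bernoulli measures giving
mass `w e` to `true` (open) and `1 - w e` to `false` (closed). -/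
def bondMeasure (G : SimpleGraph V) (w : G.edgeSet → unitInterval) : Measure (Config G) :=
  Measure.infinitePi fun e => bernoulliMeasure true false (w e)

/-- The subgraph formed by the open edges of `ω`. -/
def openGraph (ω : Config G) : SimpleGraph V where
  Adj x y := ∃ h : s(x, y) ∈ G.edgeSet, ω ⟨s(x, y), h⟩ = true
  symm := ⟨fun x y h => by simpa only [Sym2.eq_swap] using h⟩
  loopless := ⟨fun x h => G.loopless.irrefl x h.1⟩

/-- The open cluster of `x`: all vertices joined to `x` by an open path. -/
def cluster (ω : Config G) (x : V) : Set V := {y | (openGraph ω).Reachable x y}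

end General

/-- `θ_d(p)`: the probability that the open cluster of the origin is infinite in bond percolation
on `ℤ^d` where all edges are open with probability `p`. -/
def theta (d : ℕ) (p : unitInterval) : ℝ≥0∞ :=
  bondMeasure (lattice d) (fun _ => p) {ω | (cluster ω 0).Infinite}

/-- The critical threshold `p_c(d)` of bond percolation on `ℤ^d`. -/
def pc (d : ℕ) : ℝ := sSup {x : ℝ | ∃ p : unitInterval, (p : ℝ) = x ∧ theta d p = 0}

/-- The nearest-neighbour graph `ℤ^d × ℤ^s`. -/
abbrev prodLattice (d s : ℕ) : SimpleGraph ((Fin d → ℤ) × (Fin s → ℤ)) :=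
  (lattice d).boxProd (lattice s)

/-- An edge of `ℤ^d × ℤ^s` is a `ℤ^d`-edge if its endpoints differ only in their
`ℤ^d`-component. -/
def IsFirstEdge {d s : ℕ} (e : (prodLattice d s).edgeSet) : Prop :=
  ∃ (u u' : Fin d → ℤ) (v : Fin s → ℤ), (e : Sym2 _) = s((u, v), (u', v))

open Classical in
/-- `ℙ_{p,q}`: anisotropic bond percolation on `ℤ^d × ℤ^s`; the `ℤ^d`-edges are open with
probability `p` and all other edges (the `ℤ^s`-edges) with probability `q`, independently. -/
def anisoMeasure (d s : ℕ) (p q : unitInterval) : Measure (Config (prodLattice d s)) :=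
  bondMeasure (prodLattice d s) fun e => if IsFirstEdge e then p else q

/-- `θ(p,q)`: the `ℙ_{p,q}`-probability that the open cluster of the origin is infinite. -/
def anisoTheta (d s : ℕ) (p q : unitInterval) : ℝ≥0∞ :=
  anisoMeasure d s p q {ω | (cluster ω 0).Infinite}

/-- The critical curve `q_c(p) = sup {q ∈ [0,1] : θ(p,q) = 0}`. -/
def qc (d s : ℕ) (p : unitInterval) : ℝ :=
  sSup {x : ℝ | ∃ q : unitInterval, (q : ℝ) = x ∧ anisoTheta d s p q = 0}

/-- `ψ` is the crossover exponent for `ℤ^d × ℤ^s`: `q_c(p) ≈ |p - p_c(d)|^ψ` as `p ↑ p_c(d)`,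
where `≈` means that the ratio of the logarithms tends to `1`. -/
def IsCrossoverExponent (d s : ℕ) (ψ : ℝ) : Prop :=
  Tendsto (fun p : unitInterval => Real.log (qc d s p) / Real.log (|(p : ℝ) - pc d| ^ ψ))
    (comap (fun p : unitInterval => (p : ℝ)) (𝓝[<] (pc d))) (𝓝 1)

end Percolation

end

/-!
Percolation on `ℤ^d × ℤ^s` just below the critical density of `ℤ^d`.

For `d ≥ 2`, the product lattice is explored along its projection to `ℤ^d`. Each explored vertex of
`ℤ^d` is reached at some height in `ℤ^s`, and each edge of `ℤ^d` is examined once, from the height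
`y` of its explored end `u`. If the edge at height `y` is closed, a detour is tried: the vertical
edge above `(u, y)` followed by the edge at the height above. To keep the attempts at different edges
independent, every edge is first split into `2d` independent copies, one per direction, and only the
copy for the direction of the attempt is used; by Bernoulli's inequality a copy of a vertical edge is
open with probability at least `q / (2d)`. Every attempt thus succeeds with the same probability
`p' ≥ p + (1 - p) p q / (2d)`, independently of the past, so that the exploration dominates
homogeneous percolation on `ℤ^d` with density `p'` (`bondReach_le_stepReach`,
`exists_theta_le_anisoTheta`). For `q ≥ 8 d² (p_c - p)` the gain is at least
`4 d p (1 - p) (p_c - p)`, and this exceeds `p_c - p` near `p_c` because `4 d p_c (1 - p_c) > 1`. The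
latter follows from `1 / (2d - 1) ≤ p_c ≤ 2 / 3`: the lower bound `inv_le_pc` is the count of
non-backtracking walks, the upper bound `pc_le_two_thirds` is a Peierls argument in a plane.

For `d = 1` one has `p_c = 1`, and a detour does not help. Here the Peierls argument is applied to a
plane `ℤ × ℤ` with weights that distinguish the two directions
(`ae_exists_infinite_of_mul_one_sub_le`). Both uses of it are instances of
`ae_exists_infinite_of_peierls`. Its deterministic part, `exists_chain_of_finite`, says that the
contour through the rightmost point `(k, 0)` of a finite connected set containing the origin is
long; instead of planar duality it uses that the crossing number of a ray with a closed dual walk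
only changes when the starting point of the ray crosses the walk.

Positive probability is turned into an almost sure statement by Kolmogorov's zero-one law, and back
by translation invariance. The bound on the crossover exponent is read off from the linear bound on
`q_c` by taking logarithms.
-/

namespace Percolation

/-! ### Product measures and events depending on few coordinates -/

section Product

variable {I : Type*}

/-- An event that depends only on the coordinates in `S` belongs to the σ-algebra they generate. -/
lemma measurableSet_iSup_of_dependsOn {E : Set (I → Bool)} (hE : MeasurableSet E) {S : Set I}
    (h : DependsOn (fun ω => ω ∈ E) S) :
    MeasurableSet[⨆ i ∈ S, MeasurableSpace.comap (fun ω : I → Bool => ω i) inferInstance] E := by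
  classical
  let g : (I → Bool) → (I → Bool) := fun ω i => if i ∈ S then ω i else false
  have hg : E = g ⁻¹' E := by
    ext ω
    have := @h ω (g ω) (fun i hi => by simp [g, hi])
    exact Iff.of_eq this
  have hgm : @Measurable _ _
      (⨆ i ∈ S, MeasurableSpace.comap (fun ω : I → Bool => ω i) inferInstance) _ g := by
    refine @measurable_pi_lambda _ _ _ (_) _ _ fun i => ?_
    by_cases hi : i ∈ S
    · simp only [g, hi, if_true]
      refine Measurable.mono (comap_measurable _) ?_ le_rfl
      exact le_iSup₂_of_le i hi le_rfl
    · simp only [g, hi, if_false]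
      exact @measurable_const _ _ _ (_) _
  rw [hg]
  exact hgm hE

variable (μ : I → Measure Bool) [∀ i, IsProbabilityMeasure (μ i)]

lemma iIndep_comap_eval :
    iIndep (fun i => MeasurableSpace.comap (fun ω : I → Bool => ω i) inferInstance)
      (Measure.infinitePi μ) :=
  iIndepFun_infinitePi (P := μ) (X := fun _ b => b) (fun _ => measurable_id)

lemma infinitePi_inter_eq_mul {E F : Set (I → Bool)} (hE : MeasurableSet E)
    (hF : MeasurableSet F) {S T : Set I} (hES : DependsOn (fun ω => ω ∈ E) S)
    (hFT : DependsOn (fun ω => ω ∈ F) T) (hST : Disjoint S T) :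
    Measure.infinitePi μ (E ∩ F) = Measure.infinitePi μ E * Measure.infinitePi μ F := by
  have h := indep_iSup_of_disjoint (fun i => (measurable_pi_apply i).comap_le)
    (iIndep_comap_eval μ) hST
  exact (Indep_iff _ _ _).1 h E F (measurableSet_iSup_of_dependsOn hE hES)
    (measurableSet_iSup_of_dependsOn hF hFT)

/-- Kolmogorov's zero-one law, for an event insensitive to changes of finitely many coordinates. -/
lemma infinitePi_eq_zero_or_one {E : Set (I → Bool)} (hE : MeasurableSet E)
    (h : ∀ F : Set I, F.Finite → DependsOn (fun ω => ω ∈ E) Fᶜ) :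
    Measure.infinitePi μ E = 0 ∨ Measure.infinitePi μ E = 1 := by
  refine measure_zero_or_one_of_measurableSet_limsup (p := Set.Finite) (f := cofinite)
    (ns := fun F : Finset I => (F : Set I))
    (fun i => (measurable_pi_apply i).comap_le) (iIndep_comap_eval μ)
    (fun t ht => by simpa using ht) ?_ (fun F => F.finite_toSet) (fun i => ⟨{i}, by simp⟩) ?_
  · exact Monotone.directed_le fun _ _ h => Finset.coe_subset.2 h
  · rw [limsup_eq_iInf_iSup]
    simp only [MeasurableSpace.measurableSet_iInf]
    intro S hS
    exact measurableSet_iSup_of_dependsOn hE (by simpa using h Sᶜ hS)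

end Product

section Steps

variable {Ω V : Type*}

/-- `b` is reached from `a` by exactly `n` steps of the relation `r`. -/
def stepsTo (r : V → V → Prop) : ℕ → V → V → Prop
  | 0, a, b => a = b
  | n + 1, a, b => ∃ c, stepsTo r n a c ∧ r c b

lemma reflTransGen_iff_stepsTo {r : V → V → Prop} {a b : V} :
    Relation.ReflTransGen r a b ↔ ∃ n, stepsTo r n a b := by
  constructor
  · intro h
    induction h with
    | refl => exact ⟨0, rfl⟩
    | tail _ h ih => obtain ⟨n, hn⟩ := ih; exact ⟨n + 1, _, hn, h⟩
  · rintro ⟨n, hn⟩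
    induction n generalizing b with
    | zero => cases hn; exact .refl
    | succ n ih => obtain ⟨c, hc, h⟩ := hn; exact (ih hc).tail h

lemma measurableSet_reflTransGen [Countable V] [MeasurableSpace Ω] {r : Ω → V → V → Prop}
    (hr : ∀ a b, MeasurableSet {ω | r ω a b}) (a b : V) :
    MeasurableSet {ω | Relation.ReflTransGen (r ω) a b} := by
  simp only [reflTransGen_iff_stepsTo, Set.ofPred_exists]
  refine MeasurableSet.iUnion fun n => ?_
  induction n generalizing b with
  | zero => exact MeasurableSet.const _
  | succ n ih =>
    simp only [stepsTo, Set.ofPred_exists, Set.ofPred_and]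
    exact MeasurableSet.iUnion fun c => (ih c).inter (hr c b)

end Steps

/-! ### Measurability, zero-one law and translation invariance for infinite clusters -/

section Clusters

variable {V : Type*} {G : SimpleGraph V}

instance (w : G.edgeSet → unitInterval) : IsProbabilityMeasure (bondMeasure G w) := by
  unfold bondMeasure; infer_instance

lemma mem_cluster_iff {ω : Config G} {x y : V} :
    y ∈ cluster ω x ↔ Relation.ReflTransGen (openGraph ω).Adj x y :=
  SimpleGraph.reachable_iff_reflTransGen x y

lemma measurableSet_open (x y : V) : MeasurableSet {ω : Config G | (openGraph ω).Adj x y} := by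
  by_cases h : s(x, y) ∈ G.edgeSet
  · have : {ω : Config G | (openGraph ω).Adj x y} =
        (fun ω : Config G => ω ⟨s(x, y), h⟩) ⁻¹' {true} := by
      ext ω; exact ⟨fun ⟨_, h'⟩ => h', fun h' => ⟨h, h'⟩⟩
    rw [this]
    exact measurable_pi_apply _ (measurableSet_singleton _)
  · have : {ω : Config G | (openGraph ω).Adj x y} = ∅ := by
      ext ω; exact ⟨fun ⟨h', _⟩ => h h', fun h' => h'.elim⟩
    rw [this]; exact .empty

lemma infinite_iff_forall_finset {S : Set V} : S.Infinite ↔ ∀ F : Finset V, ∃ y, y ∉ F ∧ y ∈ S := by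
  constructor
  · intro h F
    obtain ⟨y, hy, hyF⟩ := h.exists_notMem_finset F
    exact ⟨y, hyF, hy⟩
  · intro h hS
    obtain ⟨y, hy, hyS⟩ := h hS.toFinset
    exact hy (by simpa using hyS)

/-- Changing the states of finitely many edges cuts an infinite cluster into finitely many pieces,
one of which is infinite. -/
lemma exists_infinite_of_eqOn_compl {F : Set G.edgeSet} (hF : F.Finite) {ω ω' : Config G}
    (h : ∀ e ∈ Fᶜ, ω e = ω' e) (hω : ∃ x, (cluster ω x).Infinite) :
    ∃ x, (cluster ω' x).Infinite := by
  obtain ⟨x, hx⟩ := hω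
  by_contra! hfin
  let W : Set V := {x} ∪ ⋃ e ∈ F, {v | v ∈ (e : Sym2 V)}
  have hW : W.Finite := by
    refine (Set.finite_singleton x).union (hF.biUnion fun e _ => ?_)
    induction (e : Sym2 V) using Sym2.ind with
    | _ a b =>
      refine Set.Finite.subset (Set.toFinite {a, b}) fun v hv => ?_
      simpa using hv
  refine hx (Set.Finite.subset (hW.biUnion fun w _ => hfin w) ?_)
  intro y hy
  rw [mem_cluster_iff] at hy
  induction hy with
  | refl => exact Set.mem_biUnion (Or.inl rfl) (SimpleGraph.Reachable.refl _)
  | @tail y z _ hyz ih =>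
    obtain ⟨hG, ho⟩ := hyz
    by_cases he : (⟨s(y, z), hG⟩ : G.edgeSet) ∈ F
    · refine Set.mem_biUnion (x := z) (Or.inr ?_) (SimpleGraph.Reachable.refl _)
      exact Set.mem_biUnion he (by simp)
    · obtain ⟨w, hw, hy⟩ := Set.mem_iUnion₂.1 ih
      refine Set.mem_biUnion hw ?_
      have hadj : (openGraph ω').Adj y z := ⟨hG, by rw [← h _ he]; exact ho⟩
      exact SimpleGraph.Reachable.trans hy hadj.reachable

variable [Countable V]

lemma measurableSet_mem_cluster (x y : V) : MeasurableSet {ω : Config G | y ∈ cluster ω x} := by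
  simp only [mem_cluster_iff]
  exact measurableSet_reflTransGen measurableSet_open x y

lemma measurableSet_infinite (x : V) : MeasurableSet {ω : Config G | (cluster ω x).Infinite} := by
  simp only [infinite_iff_forall_finset, Set.ofPred_forall, Set.ofPred_exists, Set.ofPred_and]
  refine .iInter fun F => .iUnion fun y => .inter ?_ (measurableSet_mem_cluster x y)
  exact .iInter fun _ => MeasurableSet.const False

lemma measurableSet_exists_infinite :
    MeasurableSet {ω : Config G | ∃ x, (cluster ω x).Infinite} := by
  simp only [Set.ofPred_exists]
  exact .iUnion measurableSet_infinite

/-- If there is an infinite cluster with positive probability then there is one almost surely. -/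
lemma ae_exists_infinite_of_ne_zero (w : G.edgeSet → unitInterval) (x : V)
    (h : bondMeasure G w {ω | (cluster ω x).Infinite} ≠ 0) :
    ∀ᵐ ω ∂(bondMeasure G w), ∃ x, (cluster ω x).Infinite := by
  have hdep : ∀ F : Set G.edgeSet, F.Finite →
      DependsOn (fun ω => ω ∈ {ω : Config G | ∃ x, (cluster ω x).Infinite}) Fᶜ :=
    fun F hF ω ω' hω => propext (Iff.intro (exists_infinite_of_eqOn_compl hF hω)
      (exists_infinite_of_eqOn_compl hF fun e he => (hω e he).symm))
  have h01 := infinitePi_eq_zero_or_one (fun e => bernoulliMeasure true false (w e))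
    (measurableSet_exists_infinite (G := G)) hdep
  rcases h01 with h0 | h1
  · exact absurd (measure_mono_null (fun ω (hω : (cluster ω x).Infinite) => Exists.intro x hω) h0) h
  · have := (prob_compl_eq_zero_iff (μ := bondMeasure G w)
      (measurableSet_exists_infinite (G := G))).2 h1
    exact this

/-- Automorphisms that preserve the edge weights preserve the law of the clusters. -/
lemma measure_infinite_map (w : G.edgeSet → unitInterval) (φ : G ≃g G)
    (hw : ∀ e, w (φ.mapEdgeSet e) = w e) (x : V) :
    bondMeasure G w {ω | (cluster ω (φ x)).Infinite} =
      bondMeasure G w {ω | (cluster ω x).Infinite} := by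
  have hmap : (bondMeasure G w).map (fun ω e => ω (φ.mapEdgeSet e)) = bondMeasure G w := by
    unfold bondMeasure
    rw [Measure.map_infinitePi_infinitePi_of_inj φ.mapEdgeSet.injective]
    simp only [hw]
  conv_rhs => rw [← hmap]
  rw [Measure.map_apply (by fun_prop) (measurableSet_infinite x)]
  congr 1
  ext ω
  have hadj : ∀ a b, (openGraph (fun e => ω (φ.mapEdgeSet e))).Adj a b ↔
      (openGraph ω).Adj (φ a) (φ b) := by
    intro a b
    constructor
    · rintro ⟨h, h'⟩
      exact ⟨(φ.mapEdgeSet ⟨_, h⟩).2, h'⟩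
    · rintro ⟨h, h'⟩
      exact ⟨(φ.map_adj_iff (v := a) (w := b)).1 h, h'⟩
  let ψ : openGraph (fun e => ω (φ.mapEdgeSet e)) ≃g openGraph ω :=
    ⟨φ.toEquiv, fun {a b} => (hadj a b).symm⟩
  have : cluster ω (φ x) = φ '' cluster (fun e => ω (φ.mapEdgeSet e)) x := by
    ext y
    constructor
    · intro hy
      refine ⟨φ.symm y, ?_, by simp⟩
      refine (ψ.reachable_iff (u := x) (v := φ.symm y)).1 ?_
      change (openGraph ω).Reachable (φ x) (φ (φ.symm y))
      rwa [φ.apply_symm_apply]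
    · rintro ⟨z, hz, rfl⟩
      exact (ψ.reachable_iff (u := x) (v := z)).2 hz
  simp only [Set.mem_ofPred_eq, Set.mem_preimage, this]
  exact Set.infinite_image_iff φ.injective.injOn

/-- On a transitive graph with invariant edge weights, the cluster of each vertex is infinite with
positive probability as soon as infinite clusters exist almost surely. -/
lemma measure_infinite_ne_zero (w : G.edgeSet → unitInterval) (o : V)
    (htrans : ∀ x, ∃ φ : G ≃g G, φ o = x ∧ ∀ e, w (φ.mapEdgeSet e) = w e)
    (h : ∀ᵐ ω ∂(bondMeasure G w), ∃ x, (cluster ω x).Infinite) :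
    bondMeasure G w {ω | (cluster ω o).Infinite} ≠ 0 := by
  intro h0
  have : ∀ᵐ ω ∂(bondMeasure G w), ∀ x, ¬ (cluster ω x).Infinite := by
    rw [ae_all_iff]
    intro x
    obtain ⟨φ, rfl, hφ⟩ := htrans x
    rw [ae_iff]
    simpa only [not_not, measure_infinite_map w φ hφ] using h0
  obtain ⟨ω, ⟨x, hx⟩, h'⟩ := (h.and this).exists
  exact h' x hx

end Clusters

/-! ### Lattices -/

/-- The translation by `z`, as an automorphism of the lattice. -/
def latticeShift {n : ℕ} (z : Fin n → ℤ) : lattice n ≃g lattice n where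
  toEquiv := Equiv.addRight z
  map_rel_iff' := by simp [lattice]

/-- The translation by `z`, as an automorphism of the product lattice. -/
def prodShift {d s : ℕ} (z : (Fin d → ℤ) × (Fin s → ℤ)) : prodLattice d s ≃g prodLattice d s where
  toEquiv := Equiv.addRight z
  map_rel_iff' := by simp [lattice, prodLattice, SimpleGraph.boxProd]

lemma theta_ne_zero_of_ae {d : ℕ} (p : unitInterval)
    (h : ∀ᵐ ω ∂(bondMeasure (lattice d) (fun _ => p)), ∃ x, (cluster ω x).Infinite) :
    theta d p ≠ 0 :=
  measure_infinite_ne_zero _ 0 (fun x => ⟨latticeShift x, zero_add x, fun _ => rfl⟩) h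

lemma isFirstEdge_prodShift {d s : ℕ} (z : (Fin d → ℤ) × (Fin s → ℤ))
    (e : (prodLattice d s).edgeSet) :
    IsFirstEdge ((prodShift z).mapEdgeSet e) ↔ IsFirstEdge e := by
  have key : ∀ (z : (Fin d → ℤ) × (Fin s → ℤ)) (e : (prodLattice d s).edgeSet),
      IsFirstEdge e → ∀ e' : (prodLattice d s).edgeSet,
      (e' : Sym2 _) = Sym2.map (· + z) (e : Sym2 _) → IsFirstEdge e' := by
    rintro z e ⟨u, u', v, he⟩ e' h
    refine ⟨u + z.1, u' + z.1, v + z.2, ?_⟩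
    rw [h, he]; rfl
  constructor
  · intro h
    refine key (-z) _ h e ?_
    have : (((prodShift z).mapEdgeSet e : (prodLattice d s).edgeSet) : Sym2 _) =
      Sym2.map (· + z) (e : Sym2 _) := rfl
    rw [this, Sym2.map_map]
    have hid : ((· + -z) ∘ (· + z) : (Fin d → ℤ) × (Fin s → ℤ) → _) = id := by
      ext x <;> simp
    rw [hid, Sym2.map_id, id]
  · intro h
    exact key z e h _ rfl

lemma anisoTheta_ne_zero_of_ae {d s : ℕ} {p q : unitInterval}
    (h : ∀ᵐ ω ∂(anisoMeasure d s p q), ∃ x, (cluster ω x).Infinite) :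
    anisoTheta d s p q ≠ 0 :=
  measure_infinite_ne_zero _ 0 (fun x => ⟨prodShift x, zero_add x, fun e => by
    classical exact if_congr (isFirstEdge_prodShift x e) rfl rfl⟩) h

/-! ### Counting weighted chains of edges -/

section Chains

variable {σ : Type*}

variable {V : Type*} {G : SimpleGraph V}

lemma bondMeasure_forall_mem_list (w : G.edgeSet → unitInterval) (e : σ → G.edgeSet) (b : Bool)
    {l : List σ} (hl : (l.map e).Nodup) :
    bondMeasure G w {ω | ∀ t ∈ l, ω (e t) = b} =
      (l.map fun t => bernoulliMeasure true false (w (e t)) {b}).prod := by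
  classical
  have h1 : {ω : Config G | ∀ t ∈ l, ω (e t) = b} =
      Set.pi ((l.map e).toFinset : Set G.edgeSet) (fun _ => {b}) := by
    ext ω; simp [Set.mem_pi]
  rw [h1, bondMeasure, Measure.infinitePi_pi _ (fun _ _ => measurableSet_singleton _),
    List.prod_toFinset _ hl, List.map_map]
  rfl

variable [DecidableEq σ]

/-- The lists `[t₁, …, tₙ]` such that `t₁` is a successor of `s` and each `tᵢ₊₁` is a successor
of `tᵢ`, where `next t` is the set of successors of `t`. -/
def chains (next : σ → Finset σ) : ℕ → σ → Finset (List σ)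
  | 0, _ => {[]}
  | n + 1, s => (next s).biUnion fun t => (chains next n t).image (t :: ·)

lemma cons_mem_chains {next : σ → Finset σ} {n : ℕ} {s t : σ} {l : List σ} (ht : t ∈ next s)
    (hl : l ∈ chains next n t) : t :: l ∈ chains next (n + 1) s := by
  simp only [chains, Finset.mem_biUnion, Finset.mem_image]
  exact ⟨t, ht, l, hl, rfl⟩

lemma sum_biUnion_le_sum {τ : Type*} [DecidableEq τ] (s : Finset σ) (f : σ → Finset τ)
    (w : τ → ℝ≥0∞) : ∑ x ∈ s.biUnion f, w x ≤ ∑ a ∈ s, ∑ x ∈ f a, w x := by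
  induction s using Finset.induction_on with
  | empty => simp
  | insert a s ha ih =>
    rw [Finset.biUnion_insert, Finset.sum_insert ha]
    refine le_trans ?_ (add_le_add_right ih _)
    rw [← Finset.sum_union_inter]
    exact le_self_add

/-- The total weight of the chains of length `n` is of order `r ^ n` if the weighted sum of `g ≥ 1`
over the successors of each state is at most `r` times the value of `g` at that state. -/
lemma sum_chains_le {next : σ → Finset σ} {w g : σ → ℝ≥0∞} {r : ℝ≥0∞} (hg : ∀ s, 1 ≤ g s)
    (h : ∀ s, ∑ t ∈ next s, w t * g t ≤ r * g s) (n : ℕ) (s : σ) :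
    ∑ l ∈ chains next n s, (l.map w).prod ≤ r ^ n * g s := by
  induction n generalizing s with
  | zero => simpa [chains] using hg s
  | succ n ih =>
    calc ∑ l ∈ chains next (n + 1) s, (l.map w).prod
        ≤ ∑ t ∈ next s, ∑ l ∈ (chains next n t).image (t :: ·), (l.map w).prod :=
          sum_biUnion_le_sum _ _ _
      _ ≤ ∑ t ∈ next s, w t * (r ^ n * g t) := by
          refine Finset.sum_le_sum fun t _ => ?_
          rw [Finset.sum_image (by intro a _ b _ hab; simpa using hab)]
          simp only [List.map_cons, List.prod_cons, ← Finset.mul_sum]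
          gcongr
          exact ih t
      _ = r ^ n * ∑ t ∈ next s, w t * g t := by
          rw [Finset.mul_sum]
          exact Finset.sum_congr rfl fun t _ => by ring
      _ ≤ r ^ n * (r * g s) := by gcongr; exact h s
      _ = r ^ (n + 1) * g s := by ring

/-- The union bound over chains of pairwise distinct edges in the state `b`. -/
lemma bondMeasure_exists_chain_le (w : G.edgeSet → unitInterval) (e : σ → G.edgeSet) (b : Bool)
    {next : σ → Finset σ} {g : σ → ℝ≥0∞} {r : ℝ≥0∞} (hg : ∀ s, 1 ≤ g s)
    (h : ∀ s, ∑ t ∈ next s, bernoulliMeasure true false (w (e t)) {b} * g t ≤ r * g s)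
    (n : ℕ) (s : σ) :
    bondMeasure G w {ω | ∃ l ∈ chains next n s, (l.map e).Nodup ∧ ∀ t ∈ l, ω (e t) = b} ≤
      r ^ n * g s := by
  refine le_trans ?_ (sum_chains_le hg h n s)
  have : {ω : Config G | ∃ l ∈ chains next n s, (l.map e).Nodup ∧ ∀ t ∈ l, ω (e t) = b} =
      ⋃ l ∈ chains next n s, {ω | (l.map e).Nodup ∧ ∀ t ∈ l, ω (e t) = b} := by
    ext ω; simp only [Set.mem_ofPred_eq, Set.mem_iUnion, exists_prop]
  rw [this]
  refine (measure_biUnion_finset_le _ _).trans (Finset.sum_le_sum fun l _ => ?_)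
  by_cases hl : (l.map e).Nodup
  · rw [← bondMeasure_forall_mem_list w e b hl]
    exact measure_mono fun ω hω => hω.2
  · simp [hl]

end Chains

lemma bernoulli_true (p : unitInterval) :
    bernoulliMeasure true false p {true} = ENNReal.ofReal p := by
  classical
  rw [bernoulliMeasure_apply p (measurableSet_singleton _), if_pos (by simp), if_neg (by simp)]
  rw [ENNReal.ofReal]; congr 1; ext; simp [p.2.1]

lemma bernoulli_false (p : unitInterval) :
    bernoulliMeasure true false p {false} = ENNReal.ofReal (1 - p) := by
  classical
  rw [bernoulliMeasure_apply p (measurableSet_singleton _), if_neg (by simp), if_pos (by simp)]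
  rw [ENNReal.ofReal]; congr 1; ext; simp [p.2.2]

/-! ### The lower bound for the critical threshold -/

section LowerBound

variable {d : ℕ}

/-- The `2d` unit vectors `±eᵢ` of `ℤ^d`. -/
def unitVec (l : Fin d × Bool) : Fin d → ℤ := Pi.single l.1 (if l.2 then 1 else -1)

lemma unitVec_flip (l : Fin d × Bool) : unitVec (l.1, !l.2) = -unitVec l := by
  rw [unitVec, unitVec, ← Pi.single_neg]
  cases l.2 <;> rfl

lemma sum_abs_unitVec (l : Fin d × Bool) : ∑ i, |unitVec l i| = 1 := by
  rw [Finset.sum_eq_single l.1]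
  · cases h : l.2 <;> simp [unitVec, h]
  · intro b _ hb; simp [unitVec, hb]
  · simp

lemma lattice_adj_add_unitVec (x : Fin d → ℤ) (l : Fin d × Bool) :
    (lattice d).Adj x (x + unitVec l) := by
  simpa [lattice] using sum_abs_unitVec l

lemma exists_eq_add_unitVec {x y : Fin d → ℤ} (h : (lattice d).Adj x y) :
    ∃ l, y = x + unitVec l := by
  have h1 : ∑ i, |x i - y i| = 1 := h
  obtain ⟨i, -, hi⟩ : ∃ i ∈ Finset.univ, |x i - y i| ≠ 0 :=
    Finset.exists_ne_zero_of_sum_ne_zero (by omega)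
  rw [← Finset.add_sum_erase _ _ (Finset.mem_univ i)] at h1
  have hnn : 0 ≤ ∑ j ∈ Finset.univ.erase i, |x j - y j| :=
    Finset.sum_nonneg fun _ _ => abs_nonneg _
  have hpos : 0 < |x i - y i| := lt_of_le_of_ne (abs_nonneg _) hi.symm
  have hsum : ∑ j ∈ Finset.univ.erase i, |x j - y j| = 0 := by omega
  have hi1 : |x i - y i| = 1 := by omega
  rw [Finset.sum_eq_zero_iff_of_nonneg fun _ _ => abs_nonneg _] at hsum
  have hj : ∀ j, j ≠ i → y j = x j := fun j hj => by
    have := hsum j (Finset.mem_erase.2 ⟨hj, Finset.mem_univ _⟩)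
    rw [abs_eq_zero] at this; omega
  rcases abs_eq (zero_le_one) |>.1 hi1 with h | h
  · refine ⟨(i, false), funext fun j => ?_⟩
    by_cases hji : j = i
    · subst hji; simp [unitVec]; omega
    · simp [unitVec, hji, hj j hji]
  · refine ⟨(i, true), funext fun j => ?_⟩
    by_cases hji : j = i
    · subst hji; simp [unitVec]; omega
    · simp [unitVec, hji, hj j hji]

/-- The edge from `t.1` in the direction `t.2`. -/
def stepEdge (t : (Fin d → ℤ) × (Fin d × Bool)) : (lattice d).edgeSet :=
  ⟨s(t.1, t.1 + unitVec t.2), lattice_adj_add_unitVec _ _⟩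

/-- The steps that may follow a given step in a non-backtracking walk. -/
def nextStep (t : (Fin d → ℤ) × (Fin d × Bool)) : Finset ((Fin d → ℤ) × (Fin d × Bool)) :=
  (Finset.univ.erase (t.2.1, !t.2.2)).image fun l => (t.1 + unitVec t.2, l)

lemma card_nextStep_le (t : (Fin d → ℤ) × (Fin d × Bool)) : (nextStep t).card ≤ 2 * d - 1 := by
  refine Finset.card_image_le.trans ?_
  rw [Finset.card_erase_of_mem (Finset.mem_univ _)]
  simp [mul_comm]

/-- The first `n` edges of a trail form a chain of steps: since the edges are distinct, the trail
does not backtrack. The step `t` precedes the trail. -/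
lemma exists_chain_of_isTrail {H : SimpleGraph (Fin d → ℤ)} (hH : H ≤ lattice d)
    {y z : Fin d → ℤ} (p : H.Walk y z) (hp : p.IsTrail) (n : ℕ) (hn : n ≤ p.length)
    (t : (Fin d → ℤ) × (Fin d × Bool)) (hy : y = t.1 + unitVec t.2) (ht : s(t.1, y) ∉ p.edges) :
    ∃ c ∈ chains nextStep n t, c.map (fun t => (stepEdge t : Sym2 _)) = p.edges.take n := by
  induction p generalizing n t with
  | nil =>
    obtain rfl : n = 0 := by simpa using hn
    exact ⟨[], by simp [chains], by simp⟩
  | @cons y y' z h p ih =>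
    cases n with
    | zero => exact ⟨[], by simp [chains], by simp⟩
    | succ n =>
      rw [SimpleGraph.Walk.isTrail_cons] at hp
      obtain ⟨l, rfl⟩ := exists_eq_add_unitVec (hH h)
      obtain ⟨c, hc, hc'⟩ := ih hp.1 n (by simpa using hn) (y, l) rfl hp.2
      refine ⟨(y, l) :: c, cons_mem_chains ?_ hc, by simpa [stepEdge] using hc'⟩
      simp only [nextStep, Finset.mem_image, Finset.mem_erase, Finset.mem_univ, and_true]
      refine ⟨l, ?_, by rw [hy]⟩
      rintro rfl
      apply ht
      have : y + unitVec (t.2.1, !t.2.2) = t.1 := by rw [unitVec_flip, hy]; simp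
      simp only [SimpleGraph.Walk.edges_cons, this, Sym2.eq_swap (a := y), List.mem_cons, true_or]

lemma sum_abs_sub_le_length {H : SimpleGraph (Fin d → ℤ)} (hH : H ≤ lattice d)
    {y z : Fin d → ℤ} (p : H.Walk y z) : ∑ i, |y i - z i| ≤ p.length := by
  induction p with
  | nil => simp
  | @cons y y' z h p ih =>
    have h1 : ∑ i, |y i - y' i| = 1 := hH h
    have : ∑ i, |y i - z i| ≤ ∑ i, |y i - y' i| + ∑ i, |y' i - z i| := by
      rw [← Finset.sum_add_distrib]
      exact Finset.sum_le_sum fun i _ => abs_sub_le _ _ _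
    rw [SimpleGraph.Walk.length_cons]; push_cast; omega

lemma openGraph_le {V : Type*} {G : SimpleGraph V} (ω : Config G) : openGraph ω ≤ G :=
  fun _ _ h => h.1

/-- If the cluster of the origin is infinite, then arbitrarily long open paths begin there. The first
step `l` of the path is not part of the chain. -/
lemma exists_chain_of_infinite {ω : Config (lattice d)} (h : (cluster ω 0).Infinite) (n : ℕ) :
    ∃ l, ∃ c ∈ chains nextStep n ((0 : Fin d → ℤ), l), (c.map stepEdge).Nodup ∧
      ∀ t ∈ c, ω (stepEdge t) = true := by
  classical
  obtain ⟨y, hy, hyn⟩ : ∃ y ∈ cluster ω 0, ∃ i, (n : ℤ) < |y i| := by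
    by_contra! hcon
    refine h ((Set.finite_Icc (fun _ => -(n : ℤ)) (fun _ => (n : ℤ))).subset fun y hy => ?_)
    exact ⟨fun i => (abs_le.1 (hcon y hy i)).1, fun i => (abs_le.1 (hcon y hy i)).2⟩
  obtain ⟨i, hi⟩ := hyn
  obtain ⟨p, hp⟩ := SimpleGraph.Reachable.exists_isPath hy
  have hlen : n < p.length := by
    have h1 := sum_abs_sub_le_length (openGraph_le ω) p
    have h2 : |(0 : Fin d → ℤ) i - y i| ≤ ∑ i, |(0 : Fin d → ℤ) i - y i| :=
      Finset.single_le_sum (f := fun i => |(0 : Fin d → ℤ) i - y i|)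
        (fun _ _ => abs_nonneg _) (Finset.mem_univ i)
    simp only [Pi.zero_apply, zero_sub, abs_neg] at h1 h2
    omega
  cases p with
  | nil => simp at hlen
  | @cons _ y' _ h p =>
    have hq := hp.isTrail
    rw [SimpleGraph.Walk.isTrail_cons] at hq
    obtain ⟨l, rfl⟩ := exists_eq_add_unitVec (openGraph_le ω h)
    obtain ⟨c, hc, hc'⟩ := exists_chain_of_isTrail (openGraph_le ω) p hq.1 n
      (by simpa using hlen) (0, l) rfl hq.2
    refine ⟨l, c, hc, ?_, ?_⟩
    · have hnd : (c.map fun t => (stepEdge t : Sym2 (Fin d → ℤ))).Nodup := by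
        rw [hc']; exact hq.1.edges_nodup.sublist (List.take_sublist _ _)
      refine List.Nodup.of_map Subtype.val ?_
      rwa [List.map_map]
    · intro t ht
      have h1 : (stepEdge t : Sym2 (Fin d → ℤ)) ∈ p.edges := by
        refine List.mem_of_mem_take (i := n) ?_
        rw [← hc']
        exact List.mem_map.2 ⟨t, ht, rfl⟩
      obtain ⟨h', ho⟩ := p.edges_subset_edgeSet h1
      exact ho

/-- Below density `1 / (2d - 1)` the expected number of long open non-backtracking walks from the
origin tends to zero. -/
lemma theta_eq_zero {p : unitInterval} (hp : (2 * d - 1 : ℕ) * (p : ℝ) < 1) : theta d p = 0 := by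
  classical
  set r : ℝ≥0∞ := (2 * d - 1 : ℕ) * ENNReal.ofReal p with hr
  have hr1 : r < 1 := by
    rw [hr, ← ENNReal.ofReal_natCast, ← ENNReal.ofReal_mul (by positivity), ← ENNReal.ofReal_one]
    exact (ENNReal.ofReal_lt_ofReal_iff zero_lt_one).2 hp
  have hbound : ∀ n : ℕ, theta d p ≤ ((Fintype.card (Fin d × Bool) : ℕ) : ℝ≥0∞) * r ^ n := by
    intro n
    have hsub : {ω : Config (lattice d) | (cluster ω 0).Infinite} ⊆
        ⋃ l ∈ (Finset.univ : Finset (Fin d × Bool)),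
          {ω | ∃ c ∈ chains nextStep n ((0 : Fin d → ℤ), l), (c.map stepEdge).Nodup ∧
            ∀ t ∈ c, ω (stepEdge t) = true} := fun ω hω => by
      simpa using exists_chain_of_infinite hω n
    refine (measure_mono hsub).trans ((measure_biUnion_finset_le _ _).trans ?_)
    refine (Finset.sum_le_card_nsmul _ _ (r ^ n) fun l _ => ?_).trans (by simp)
    have := bondMeasure_exists_chain_le (G := lattice d) (fun _ => p) stepEdge true
      (next := nextStep) (g := fun _ => 1) (r := r) (fun _ => le_rfl) (fun s => ?_) n (0, l)
    · simpa using this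
    · simp only [bernoulli_true, mul_one, Finset.sum_const, nsmul_eq_mul, hr]
      gcongr
      exact card_nextStep_le s
  have hlim : Tendsto (fun n => ((Fintype.card (Fin d × Bool) : ℕ) : ℝ≥0∞) * r ^ n) atTop (𝓝 0) := by
    simpa only [mul_zero] using ENNReal.Tendsto.const_mul (ENNReal.tendsto_pow_atTop_nhds_zero_of_lt_one hr1)
      (Or.inr (ENNReal.natCast_ne_top _))
  exact le_antisymm (ge_of_tendsto' hlim hbound) zero_le

lemma bddAbove_pc (d : ℕ) : BddAbove {x : ℝ | ∃ p : unitInterval, (p : ℝ) = x ∧ theta d p = 0} :=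
  ⟨1, by rintro _ ⟨p, rfl, -⟩; exact p.2.2⟩

lemma pc_le_one (d : ℕ) : pc d ≤ 1 :=
  Real.sSup_le (by rintro _ ⟨p, rfl, -⟩; exact p.2.2) zero_le_one

lemma inv_le_pc (hd : 1 ≤ d) : ((2 * d - 1 : ℕ) : ℝ)⁻¹ ≤ pc d := by
  have hpos : (1 : ℝ) ≤ ((2 * d - 1 : ℕ) : ℝ) := by exact_mod_cast (by omega : 1 ≤ 2 * d - 1)
  refine le_of_forall_lt fun x hx => ?_
  obtain ⟨y, hy, hy'⟩ := exists_between (max_lt hx (inv_pos.2 (zero_lt_one.trans_le hpos)))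
  have hy0 : 0 ≤ y := (le_max_right _ _).trans hy.le
  have hy1 : y ≤ 1 := hy'.le.trans (inv_le_one_of_one_le₀ hpos)
  refine ((le_max_left _ _).trans_lt hy).trans_le (le_csSup (bddAbove_pc d) ⟨⟨y, hy0, hy1⟩, rfl, ?_⟩)
  refine theta_eq_zero ?_
  rwa [← lt_inv_mul_iff₀ (by linarith), mul_one]

lemma theta_ne_zero_of_pc_lt {p : unitInterval} (h : pc d < p) : theta d p ≠ 0 := fun h0 =>
  h.not_ge (le_csSup (bddAbove_pc d) ⟨p, rfl, h0⟩)

end LowerBound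

/-! ### Boundary contours of finite planar sets -/

section Contour

/-- The four unit vectors of `ℤ²` in counterclockwise order, beginning with east. -/
def dir : Fin 4 → ℤ × ℤ := ![(1, 0), (0, 1), (-1, 0), (0, -1)]

lemma dir_add_two (d : Fin 4) : dir (d + 1 + 1) = -dir d := by
  fin_cases d <;> rfl

lemma dir_add_three (d : Fin 4) : dir (d + 3) = -dir (d + 1) := by
  fin_cases d <;> rfl

lemma dir_injective : Function.Injective dir := by decide

/-- A dart `(a, d)` represents the edge from `a` to `a + dir d`, crossed by the dual edge that has
`a` on its left. It is on the boundary of `S` if `a ∈ S` and `a + dir d ∉ S`. -/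
def IsBoundary (S : Set (ℤ × ℤ)) (t : (ℤ × ℤ) × Fin 4) : Prop := t.1 ∈ S ∧ t.1 + dir t.2 ∉ S

/-- The darts whose dual edges may follow the dual edge of `t` in a walk without immediate
reversals: a left turn, a step ahead, and a right turn. -/
def nextDart (t : (ℤ × ℤ) × Fin 4) : Finset ((ℤ × ℤ) × Fin 4) :=
  {(t.1, t.2 + 1), (t.1 + dir (t.2 + 1), t.2), (t.1 + dir (t.2 + 1) + dir t.2, t.2 + 3)}

open Classical in
/-- The successor of a boundary dart of `S` in the contour that keeps `S` on the left. Where two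
contours touch diagonally, the left turn is taken. -/
noncomputable def contourNext (S : Set (ℤ × ℤ)) (t : (ℤ × ℤ) × Fin 4) : (ℤ × ℤ) × Fin 4 :=
  if t.1 + dir (t.2 + 1) ∈ S then
    if t.1 + dir (t.2 + 1) + dir t.2 ∈ S then (t.1 + dir (t.2 + 1) + dir t.2, t.2 + 3)
    else (t.1 + dir (t.2 + 1), t.2)
  else (t.1, t.2 + 1)

open Classical in
/-- The predecessor of a boundary dart in the contour that keeps `S` on the left. -/
noncomputable def contourPrev (S : Set (ℤ × ℤ)) (t : (ℤ × ℤ) × Fin 4) : (ℤ × ℤ) × Fin 4 :=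
  if t.1 - dir (t.2 + 1) ∈ S then
    if t.1 - dir (t.2 + 1) + dir t.2 ∈ S then (t.1 - dir (t.2 + 1) + dir t.2, t.2 + 1)
    else (t.1 - dir (t.2 + 1), t.2)
  else (t.1, t.2 + 3)

variable {S : Set (ℤ × ℤ)} {t : (ℤ × ℤ) × Fin 4}

lemma contourNext_mem_nextDart : contourNext S t ∈ nextDart t := by
  unfold contourNext nextDart
  split_ifs <;> simp

lemma IsBoundary.contourNext (ht : IsBoundary S t) : IsBoundary S (contourNext S t) := by
  obtain ⟨h1, h2⟩ := ht
  unfold Percolation.contourNext IsBoundary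
  split_ifs with h3 h4
  · exact ⟨h4, by simpa [dir_add_three, add_right_comm] using h2⟩
  · exact ⟨h3, h4⟩
  · exact ⟨h1, h3⟩

/-- The contour map is injective on the boundary darts. -/
lemma contourPrev_contourNext (ht : IsBoundary S t) : contourPrev S (contourNext S t) = t := by
  obtain ⟨a, d⟩ := t
  obtain ⟨h1, h2⟩ := ht
  unfold contourNext
  simp only at h1 h2 ⊢
  have e1 : d + 1 + 3 = d := by fin_cases d <;> rfl
  have e2 : d + 3 + 1 = d := by fin_cases d <;> rfl
  split_ifs with h3 h4
  · have h5 : a + dir (d + 1) + dir d - dir (d + 3 + 1) = a + dir (d + 1) := by rw [e2]; abel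
    have h6 : a + dir (d + 1) + dir (d + 3) = a := by rw [dir_add_three]; abel
    rw [contourPrev, if_pos (by rwa [h5]), if_pos (by rwa [h5, h6]), h5, h6, e2]
  · have h5 : a + dir (d + 1) - dir (d + 1) = a := by abel
    rw [contourPrev, if_pos (by rwa [h5]), if_neg (by rwa [h5]), h5]
  · have h5 : a - dir (d + 1 + 1) = a + dir d := by rw [dir_add_two]; abel
    rw [contourPrev, if_neg (by rwa [h5]), e1]

/-- The signed crossing of the rightward ray from `x` with the dual edge of `t`. -/
def rayCrossing (x : ℤ × ℤ) (t : (ℤ × ℤ) × Fin 4) : ℤ :=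
  (if t.2 = 0 ∧ t.1.2 = x.2 ∧ x.1 ≤ t.1.1 then 1 else 0) -
    (if t.2 = 2 ∧ t.1.2 = x.2 ∧ x.1 ≤ t.1.1 - 1 then 1 else 0)

/-- The lower left corner of the unit square in which the dual edge of `t` begins. -/
def dualTail (t : (ℤ × ℤ) × Fin 4) : ℤ × ℤ :=
  t.1 + (![(0, -1), (0, 0), (-1, 0), (-1, -1)] : Fin 4 → ℤ × ℤ) t.2

/-- The indicator of the unit squares that lie between the rightward rays from `x` and from
`x + (0, 1)`. -/
def squareBetween (x s : ℤ × ℤ) : ℤ := if s.2 = x.2 ∧ x.1 ≤ s.1 then 1 else 0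

lemma rayCrossing_sub_right (x : ℤ × ℤ) (t : (ℤ × ℤ) × Fin 4) :
    rayCrossing x t - rayCrossing (x + dir 0) t =
      (if t.2 = 0 ∧ t.1 = x then 1 else 0) -
        (if t.2 = 2 ∧ t.1 = x + dir 0 then 1 else 0) := by
  obtain ⟨⟨a, b⟩, d⟩ := t
  obtain ⟨x, y⟩ := x
  fin_cases d <;> simp [rayCrossing, dir] <;> grind

/-- Two rays one above the other are crossed by the same number of edges of a closed dual walk,
except for the edges that separate their starting points: the boundary term telescopes. -/
lemma rayCrossing_sub_up (x : ℤ × ℤ) {t t' : (ℤ × ℤ) × Fin 4} (h : t' ∈ nextDart t) :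
    rayCrossing x t - rayCrossing (x + dir 1) t =
      (squareBetween x (dualTail t') - squareBetween x (dualTail t)) +
      ((if t.2 = 1 ∧ t.1 = x then 1 else 0) -
        (if t.2 = 3 ∧ t.1 = x + dir 1 then 1 else 0)) := by
  have hhead : dualTail t' =
      t.1 + (![(0, 0), (-1, 0), (-1, -1), (0, -1)] : Fin 4 → ℤ × ℤ) t.2 := by
    obtain ⟨a, d⟩ := t
    simp only [nextDart, Finset.mem_insert, Finset.mem_singleton] at h
    rcases h with rfl | rfl | rfl <;> simp only [dualTail] <;> fin_cases d <;>
      simp [dir, add_assoc]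
  rw [hhead]
  obtain ⟨⟨a, b⟩, d⟩ := t
  obtain ⟨x, y⟩ := x
  fin_cases d <;> simp [rayCrossing, dir, squareBetween, dualTail] <;> grind

lemma map_range_mem_chains {σ : Type*} [DecidableEq σ] {next : σ → Finset σ} (k : ℕ) (s : ℕ → σ)
    (hs : ∀ i, s (i + 1) ∈ next (s i)) :
    (List.range k).map (fun i => s (i + 1)) ∈ chains next k (s 0) := by
  induction k generalizing s with
  | zero => simp [chains]
  | succ k ih =>
    rw [List.range_succ_eq_map, List.map_cons, List.map_map]
    exact cons_mem_chains (hs 0) (ih (fun i => s (i + 1)) fun i => hs (i + 1))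

lemma fst_sub_one_le_of_mem_nextDart {t t' : (ℤ × ℤ) × Fin 4} (h : t' ∈ nextDart t) : t.1.1 - 1 ≤ t'.1.1 := by
  obtain ⟨⟨a, b⟩, d⟩ := t
  simp only [nextDart, Finset.mem_insert, Finset.mem_singleton] at h
  rcases h with rfl | rfl | rfl <;> fin_cases d <;> simp [dir] <;> omega

/-- The contour through the rightmost point `(k, 0)` of `S` on the horizontal axis reaches
the column of the origin, so it contains `k` successive darts after the first one. -/
lemma exists_chain_of_finite (hS : S.Finite) (h0 : (0, 0) ∈ S)
    (hconn : ∀ z ∈ S,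
      Relation.ReflTransGen (fun a b => a ∈ S ∧ b ∈ S ∧ ∃ d, b = a + dir d) (0, 0) z) :
    ∃ k : ℕ, (∀ j : ℤ, (j, 0) ∈ S → j ≤ k) ∧
      ∃ l ∈ chains nextDart k ((k, 0), 0), l.Nodup ∧ ∀ t ∈ l, IsBoundary S t := by
  classical
  obtain ⟨k, hkS, hkmax⟩ : ∃ k : ℤ, (k, (0 : ℤ)) ∈ S ∧ ∀ j : ℤ, (j, (0 : ℤ)) ∈ S → j ≤ k := by
    have hfin : ((fun j : ℤ => (j, (0 : ℤ))) ⁻¹' S).Finite :=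
      hS.preimage (fun a _ b _ h => (Prod.ext_iff.1 h).1)
    obtain ⟨k, hk, hk'⟩ := hfin.exists_maximalFor id _ ⟨0, h0⟩
    exact ⟨k, hk, fun j hj => by by_contra hlt; exact hlt (hk' hj (not_le.1 hlt).le)⟩
  lift k to ℕ using hkmax 0 h0
  refine ⟨k, hkmax, ?_⟩
  -- The contour through the rightmost point, as the orbit of an injective map on a finite type.
  let B := {t : (ℤ × ℤ) × Fin 4 // IsBoundary S t}
  have hBfin : Finite B := by
    refine Set.Finite.to_subtype (s := {t | IsBoundary S t})
      ((hS.prod (Set.finite_univ (α := Fin 4))).subset ?_)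
    exact fun t ht => ⟨ht.1, trivial⟩
  let f : B → B := fun t => ⟨contourNext S t.1, t.2.contourNext⟩
  have hf : Function.Injective f := fun t t' h => Subtype.ext <| by
    rw [← contourPrev_contourNext t.2, ← contourPrev_contourNext t'.2]
    exact congrArg (fun t : B => contourPrev S t.1) h
  have hs0 : IsBoundary S (((k : ℤ), (0 : ℤ)), 0) := by
    refine ⟨hkS, fun h => ?_⟩
    have := hkmax (k + 1) (by simpa [dir] using h)
    omega
  let t₀ : B := ⟨_, hs0⟩
  let s : ℕ → (ℤ × ℤ) × Fin 4 := fun n => (f^[n] t₀).1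
  have hsB : ∀ n, IsBoundary S (s n) := fun n => (f^[n] t₀).2
  have hsnext : ∀ n, s (n + 1) ∈ nextDart (s n) := fun n => by
    simp only [s, Function.iterate_succ_apply']
    exact contourNext_mem_nextDart
  set m := Function.minimalPeriod f t₀ with hm
  have hmpos : 0 < m := Function.minimalPeriod_pos_of_mem_periodicPts (hf.mem_periodicPts t₀)
  have hsm : s m = s 0 := congrArg Subtype.val (Function.iterate_minimalPeriod (f := f) (x := t₀))
  have hinj : ∀ i < m, ∀ j < m, s i = s j → i = j := fun i hi j hj h =>
    Function.iterate_injOn_Iio_minimalPeriod (f := f) (x := t₀) hi hj (Subtype.ext h)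
  -- The total crossing number of rays, which is constant on `S`.
  let H : ℤ × ℤ → ℤ := fun x => ∑ n ∈ Finset.range m, rayCrossing x (s n)
  have hright : ∀ x, x ∈ S → x + dir 0 ∈ S → H x = H (x + dir 0) := by
    intro x hx hx'
    refine Finset.sum_congr rfl fun n _ => ?_
    have h := rayCrossing_sub_right x (s n)
    obtain ⟨hn1, hn2⟩ := hsB n
    rw [if_neg, if_neg] at h
    · omega
    · rintro ⟨h1, h2⟩
      rw [h1, h2, show dir 2 = -dir 0 from rfl, add_neg_cancel_right] at hn2
      exact hn2 hx
    · rintro ⟨h1, h2⟩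
      rw [h1, h2] at hn2
      exact hn2 hx'
  have hup : ∀ x, (∀ n < m, ¬ ((s n).2 = 1 ∧ (s n).1 = x)) →
      (∀ n < m, ¬ ((s n).2 = 3 ∧ (s n).1 = x + dir 1)) → H x = H (x + dir 1) := by
    intro x h1 h2
    rw [← sub_eq_zero, ← Finset.sum_sub_distrib]
    have : ∀ n ∈ Finset.range m, rayCrossing x (s n) - rayCrossing (x + dir 1) (s n) =
        squareBetween x (dualTail (s (n + 1))) - squareBetween x (dualTail (s n)) := by
      intro n hn
      rw [rayCrossing_sub_up x (hsnext n), if_neg (h1 n (Finset.mem_range.1 hn)),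
        if_neg (h2 n (Finset.mem_range.1 hn))]
      omega
    rw [Finset.sum_congr rfl this,
      Finset.sum_range_sub (fun n => squareBetween x (dualTail (s n))), hsm, sub_self]
  have hup' : ∀ x, x ∈ S → x + dir 1 ∈ S → H x = H (x + dir 1) := by
    intro x hx hx'
    refine hup x (fun n _ => ?_) (fun n _ => ?_)
    · rintro ⟨h1, h2⟩
      have := (hsB n).2
      rw [h1, h2] at this
      exact this hx'
    · rintro ⟨h1, h2⟩
      have := (hsB n).2
      rw [h1, h2, show dir 3 = -dir 1 from rfl, add_neg_cancel_right] at this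
      exact this hx
  have hHconst : ∀ z ∈ S, H (0, 0) = H z := by
    intro z hz
    have h := hconn z hz
    clear hz
    induction h with
    | refl => rfl
    | @tail a b _ hab ih =>
      obtain ⟨ha, hb, d, rfl⟩ := hab
      rw [ih]
      fin_cases d
      · exact hright a ha hb
      · exact hup' a ha hb
      · have h2 : a + dir 2 + dir 0 = a := neg_add_cancel_right a (dir 0)
        exact ((hright (a + dir 2) hb (by rwa [h2])).trans (by rw [h2])).symm
      · have h2 : a + dir 3 + dir 1 = a := neg_add_cancel_right a (dir 1)
        exact ((hup' (a + dir 3) hb (by rwa [h2])).trans (by rw [h2])).symm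
  have hHk : H (k, 0) = 1 := by
    simp only [H]
    rw [Finset.sum_eq_single 0]
    · simp [rayCrossing, s, t₀]
    · intro n hn hn0
      simp only [rayCrossing]
      have hnS := (hsB n).1
      rw [if_neg, if_neg, sub_zero]
      · rintro ⟨-, h2, h3⟩
        have := hkmax (s n).1.1 (by rw [← h2]; exact hnS)
        omega
      · rintro ⟨h1, h2, h3⟩
        have h4 := hkmax (s n).1.1 (by rw [← h2]; exact hnS)
        refine hn0 (hinj n (Finset.mem_range.1 hn) 0 hmpos ?_)
        exact Prod.ext (Prod.ext (le_antisymm h4 h3) h2) h1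
    · simp [hmpos.ne']
  -- If the contour avoided the column of the origin, the crossing number would be constant
  -- along that column, and it vanishes far away.
  obtain ⟨n, hnm, hn⟩ : ∃ n < m, (s n).1.1 = 0 := by
    by_contra! hne
    have hcol : ∀ j : ℕ, H (0, 0) = H (0, (j : ℤ)) := by
      intro j
      induction j with
      | zero => rfl
      | succ j ih =>
        rw [ih, hup (0, (j : ℤ)) (fun n hn h => hne n hn (by rw [h.2]))
          (fun n hn h => hne n hn (by rw [h.2]; rfl))]
        simp [dir]
    obtain ⟨M, hM⟩ : ∃ M : ℕ, ∀ z ∈ S, z.2 < M := by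
      obtain ⟨M, hM⟩ := (hS.image Prod.snd).bddAbove
      refine ⟨M.toNat + 1, fun z hz => ?_⟩
      have : z.2 ≤ M := hM ⟨z, hz, rfl⟩
      omega
    have hzero : H (0, (M : ℤ)) = 0 := by
      refine Finset.sum_eq_zero fun n _ => ?_
      have := hM _ (hsB n).1
      rw [rayCrossing, if_neg, if_neg, sub_zero]
      · rintro ⟨-, h, -⟩; simp only at h; omega
      · rintro ⟨-, h, -⟩; simp only at h; omega
    have h1 := hHconst _ hkS
    have h2 := hcol M
    omega
  have hkn : k ≤ n := by
    have : ∀ i : ℕ, (k : ℤ) - i ≤ (s i).1.1 := by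
      intro i
      induction i with
      | zero => simp [s, t₀]
      | succ i ih =>
        have := fst_sub_one_le_of_mem_nextDart (hsnext i)
        push_cast
        omega
    have := this n
    omega
  refine ⟨_, map_range_mem_chains k s hsnext, ?_, ?_⟩
  · refine List.Nodup.map_on (fun i hi j hj h => ?_) List.nodup_range
    rw [List.mem_range] at hi hj
    have := hinj (i + 1) (by omega) (j + 1) (by omega) h
    omega
  · intro t ht
    obtain ⟨i, -, rfl⟩ := List.mem_map.1 ht
    exact hsB _

end Contour

/-! ### The Peierls argument -/

section Peierls

variable {V : Type*} {G : SimpleGraph V} {φ : ℤ × ℤ → V}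

/-- The edge of `G` that corresponds to a dart of the embedded square lattice. -/
def dartEdge (hφ : ∀ a d, G.Adj (φ a) (φ (a + dir d))) (t : (ℤ × ℤ) × Fin 4) : G.edgeSet :=
  ⟨s(φ t.1, φ (t.1 + dir t.2)), hφ t.1 t.2⟩

/-- If all clusters are finite, then contours around arbitrarily long segments produce long
chains of closed edges. -/
lemma exists_closed_chain (hφ : ∀ a d, G.Adj (φ a) (φ (a + dir d))) (hinj : Function.Injective φ)
    {ω : Config G} (hfin : ∀ x, (cluster ω x).Finite) (N : ℕ) :
    ∃ k : ℕ, N ≤ k ∧ ∃ l ∈ chains nextDart k (((k : ℤ), (0 : ℤ)), 0),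
      (l.map (dartEdge hφ)).Nodup ∧ ∀ t ∈ l, ω (dartEdge hφ t) = false := by
  let R : ℤ × ℤ → ℤ × ℤ → Prop := fun a b => ∃ d, b = a + dir d ∧ ω (dartEdge hφ (a, d)) = true
  let S : Set (ℤ × ℤ) := {z | ∃ i : ℕ, i ≤ N ∧ Relation.ReflTransGen R ((i : ℤ), 0) z}
  have hSfin : S.Finite := by
    refine (((Set.finite_Iic N).biUnion fun i _ => hfin (φ ((i : ℤ), 0))).preimage
      (f := φ) hinj.injOn).subset ?_
    rintro z ⟨i, hi, hz⟩
    refine Set.mem_biUnion (x := i) hi ?_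
    rw [mem_cluster_iff]
    refine Relation.ReflTransGen.lift φ ?_ _ _ hz
    rintro a _ ⟨d, rfl, hd⟩
    exact ⟨hφ a d, hd⟩
  have hseg : ∀ i : ℕ, i ≤ N → ((i : ℤ), (0 : ℤ)) ∈ S := fun i hi => ⟨i, hi, .refl⟩
  have hclosed : ∀ a b, a ∈ S → R a b → b ∈ S := fun a b ⟨i, hi, h⟩ hab => ⟨i, hi, h.tail hab⟩
  have hconn : ∀ z ∈ S,
      Relation.ReflTransGen (fun a b => a ∈ S ∧ b ∈ S ∧ ∃ d, b = a + dir d) (0, 0) z := by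
    rintro z ⟨i, hi, hz⟩
    have h1 : Relation.ReflTransGen (fun a b => a ∈ S ∧ b ∈ S ∧ ∃ d, b = a + dir d) (0, 0)
        ((i : ℤ), 0) := by
      clear hz
      induction i with
      | zero => exact .refl
      | succ i ih =>
        exact (ih (by omega)).tail ⟨hseg i (by omega), hseg (i + 1) hi, 0, by simp [dir]⟩
    induction hz with
    | refl => exact h1
    | @tail a b ha hab ih =>
      have haS : a ∈ S := ⟨i, hi, ha⟩
      exact ih.tail ⟨haS, hclosed a b haS hab, hab.imp fun d hd => hd.1⟩
  obtain ⟨k, hk, l, hl, hnd, hbd⟩ := exists_chain_of_finite hSfin (hseg 0 (Nat.zero_le _)) hconn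
  refine ⟨k, by exact_mod_cast hk N (hseg N le_rfl), l, hl, ?_, ?_⟩
  · refine List.Nodup.map_on (fun t ht t' ht' h => ?_) hnd
    have h' := congrArg Subtype.val h
    simp only [dartEdge, Sym2.eq_iff] at h'
    rcases h' with ⟨h1, h2⟩ | ⟨h1, -⟩
    · have h1 := hinj h1
      have h2 := hinj h2
      rw [h1, add_right_inj] at h2
      exact Prod.ext h1 (dir_injective h2)
    · have h3 := (hbd t ht).1
      rw [hinj h1] at h3
      exact absurd h3 (hbd t' ht').2
  · intro t ht
    by_contra hω
    exact (hbd t ht).2 (hclosed _ _ (hbd t ht).1 ⟨t.2, rfl, by simpa using hω⟩)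

/-- The Peierls argument for an embedded square lattice whose horizontal edges are closed with
probability at most `α` and whose vertical edges are closed with probability at most `β`. The
constant `c` is the weight given to horizontal edges in the count of contours. -/
lemma ae_exists_infinite_of_peierls (w : G.edgeSet → unitInterval)
    (hφ : ∀ a d, G.Adj (φ a) (φ (a + dir d))) (hinj : Function.Injective φ)
    {α β c r : ℝ} (hα : 0 ≤ α) (hβ : 0 ≤ β) (hc : 1 ≤ c) (hr : r < 1)
    (hαw : ∀ a d, d = 0 ∨ d = 2 → 1 - (w (dartEdge hφ (a, d)) : ℝ) ≤ α)
    (hβw : ∀ a d, d = 1 ∨ d = 3 → 1 - (w (dartEdge hφ (a, d)) : ℝ) ≤ β)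
    (h1 : β + 2 * α * c ≤ r) (h2 : α * c + 2 * β ≤ r * c) :
    ∀ᵐ ω ∂(bondMeasure G w), ∃ x, (cluster ω x).Infinite := by
  have hr0 : 0 ≤ r := le_trans (by positivity) h1
  let g : Fin 4 → ℝ := fun d => if d = 0 ∨ d = 2 then c else 1
  let γ : Fin 4 → ℝ := fun d => if d = 0 ∨ d = 2 then α else β
  have hg : ∀ d, 1 ≤ g d := fun d => by simp only [g]; split_ifs <;> linarith
  have hγ : ∀ d, 0 ≤ γ d := fun d => by simp only [γ]; split_ifs <;> linarith
  have hw : ∀ t, bernoulliMeasure true false (w (dartEdge hφ t)) {false} ≤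
      ENNReal.ofReal (γ t.2) := by
    rintro ⟨a, d⟩
    rw [bernoulli_false]
    refine ENNReal.ofReal_le_ofReal ?_
    simp only [γ]
    split_ifs with hd
    · exact hαw a d hd
    · exact hβw a d (by fin_cases d <;> simp_all)
  have hγg : ∀ d, γ (d + 1) * g (d + 1) + (γ d * g d + γ (d + 3) * g (d + 3)) ≤ r * g d := by
    intro d
    fin_cases d <;> simp [γ, g] <;> linarith
  have hstep : ∀ t : (ℤ × ℤ) × Fin 4, ∑ u ∈ nextDart t,
      bernoulliMeasure true false (w (dartEdge hφ u)) {false} * ENNReal.ofReal (g u.2) ≤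
        ENNReal.ofReal r * ENNReal.ofReal (g t.2) := by
    rintro ⟨a, d⟩
    have hd1 : d + 1 ≠ d ∧ d + 1 ≠ d + 3 ∧ d ≠ d + 3 := by revert d; decide
    refine (Finset.sum_le_sum (g := fun u : (ℤ × ℤ) × Fin 4 => ENNReal.ofReal (γ u.2 * g u.2))
      fun u _ => ?_).trans ?_
    · rw [ENNReal.ofReal_mul (hγ _)]
      gcongr
      exact hw u
    · have hnn : ∀ d, 0 ≤ γ d * g d := fun d => mul_nonneg (hγ d) (zero_le_one.trans (hg d))
      rw [nextDart, Finset.sum_insert (by simp [hd1]), Finset.sum_insert (by simp [hd1]),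
        Finset.sum_singleton, ← ENNReal.ofReal_mul hr0, ← ENNReal.ofReal_add (hnn _) (hnn _),
        ← ENNReal.ofReal_add (hnn _) (add_nonneg (hnn _) (hnn _))]
      exact ENNReal.ofReal_le_ofReal (hγg d)
  let B : ℕ → Set (Config G) := fun k => {ω | ∃ l ∈ chains nextDart k (((k : ℤ), (0 : ℤ)), 0),
    (l.map (dartEdge hφ)).Nodup ∧ ∀ t ∈ l, ω (dartEdge hφ t) = false}
  have hB : ∀ k, bondMeasure G w (B k) ≤ ENNReal.ofReal r ^ k * ENNReal.ofReal (g 0) := fun k =>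
    bondMeasure_exists_chain_le w (dartEdge hφ) false (g := fun t => ENNReal.ofReal (g t.2))
      (fun t => by simpa using ENNReal.ofReal_le_ofReal (hg t.2)) hstep k _
  have hsum : ∑' k, bondMeasure G w (B k) ≠ ∞ := by
    refine ne_top_of_le_ne_top ?_ (ENNReal.tsum_le_tsum hB)
    rw [ENNReal.tsum_mul_right, ENNReal.tsum_geometric]
    refine ENNReal.mul_ne_top (ENNReal.inv_ne_top.2 ?_) ENNReal.ofReal_ne_top
    rw [Ne, tsub_eq_zero_iff_le, not_le, ← ENNReal.ofReal_one]
    exact (ENNReal.ofReal_lt_ofReal_iff zero_lt_one).2 hr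
  filter_upwards [ae_eventually_notMem hsum] with ω hω
  by_contra! hfin
  obtain ⟨N, hN⟩ := eventually_atTop.1 hω
  obtain ⟨k, hk, hkB⟩ := exists_closed_chain hφ hinj hfin N
  exact hN k hk hkB

end Peierls

/-! ### Comparison of an exploration with Bernoulli percolation -/

section Exploration

variable {V Y I : Type*} {G : SimpleGraph V}

lemma reflTransGen_mono {X : Type*} {r p : X → X → Prop} {a b : X} (h : Relation.ReflTransGen r a b)
    (hrp : ∀ x y, r x y → p x y) : Relation.ReflTransGen p a b :=
  Relation.ReflTransGen.mono hrp _ _ h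

/-- Percolation on `G`, restricted to the edges in `U`, leads from `A` to `T`. -/
def bondReach (G : SimpleGraph V) (U : Finset (Sym2 V)) (A T : Set V) : Set (Config G) :=
  {ω | ∃ a ∈ A, ∃ b ∈ T,
    Relation.ReflTransGen (fun x y => s(x, y) ∈ U ∧ (openGraph ω).Adj x y) a b}

/-- A vertex `x` of `G` at height `y` leads to the neighbour `x'` at height `y'` whenever
`step ω x x' y = some y'`. Along edges in `U`, such steps lead from `H` to some vertex in `T`. -/
def stepReach (G : SimpleGraph V) (step : (I → Bool) → V → V → Y → Option Y) (U : Finset (Sym2 V))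
    (H : Set (V × Y)) (T : Set V) : Set (I → Bool) :=
  {ω | ∃ a ∈ H, ∃ b : V × Y, b.1 ∈ T ∧ Relation.ReflTransGen
    (fun x y => s(x.1, y.1) ∈ U ∧ G.Adj x.1 y.1 ∧ step ω x.1 y.1 x.2 = some y.2) a b}

lemma measurableSet_bondReach [Countable V] (U : Finset (Sym2 V)) (A T : Set V) :
    MeasurableSet (bondReach G U A T) := by
  simp only [bondReach, Set.ofPred_exists, Set.ofPred_and]
  refine .iUnion fun a => .inter (MeasurableSet.const (a ∈ A)) (.iUnion fun b =>
    .inter (MeasurableSet.const (b ∈ T)) (measurableSet_reflTransGen (fun x y => ?_) a b))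
  exact (MeasurableSet.const (s(x, y) ∈ U)).inter (measurableSet_open x y)

lemma measurableSet_stepReach [Countable V] [Countable Y]
    {step : (I → Bool) → V → V → Y → Option Y}
    (hmeas : ∀ u u' y o, MeasurableSet {ω | step ω u u' y = o}) (U : Finset (Sym2 V))
    (H : Set (V × Y)) (T : Set V) : MeasurableSet (stepReach G step U H T) := by
  simp only [stepReach, Set.ofPred_exists, Set.ofPred_and]
  refine .iUnion fun a => .inter (MeasurableSet.const (a ∈ H)) (.iUnion fun b =>
    .inter (MeasurableSet.const (b.1 ∈ T)) (measurableSet_reflTransGen (fun x y => ?_) a b))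
  exact (MeasurableSet.const (s(x.1, y.1) ∈ U)).inter
    ((MeasurableSet.const (G.Adj x.1 y.1)).inter (hmeas _ _ _ _))

lemma dependsOn_bondReach (U : Finset (Sym2 V)) (A T : Set V) :
    DependsOn (fun ω => ω ∈ bondReach G U A T) {e | (e : Sym2 V) ∈ U} := by
  intro ω ω' h
  have : (fun x y => s(x, y) ∈ U ∧ (openGraph ω).Adj x y) =
      (fun x y => s(x, y) ∈ U ∧ (openGraph ω').Adj x y) := by
    ext x y
    refine and_congr_right fun hU => exists_congr fun hG => ?_
    rw [h ⟨_, hG⟩ hU]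
  simp only [bondReach, Set.mem_ofPred_eq, this]

lemma dependsOn_stepReach {base : I → Sym2 V} {step : (I → Bool) → V → V → Y → Option Y}
    (hdep : ∀ u u' y, G.Adj u u' → DependsOn (fun ω => step ω u u' y) {i | base i = s(u, u')})
    (U : Finset (Sym2 V)) (H : Set (V × Y)) (T : Set V) :
    DependsOn (fun ω => ω ∈ stepReach G step U H T) {i | base i ∈ U} := by
  intro ω ω' h
  have : (fun x y : V × Y => s(x.1, y.1) ∈ U ∧ G.Adj x.1 y.1 ∧ step ω x.1 y.1 x.2 = some y.2) =
      (fun x y => s(x.1, y.1) ∈ U ∧ G.Adj x.1 y.1 ∧ step ω' x.1 y.1 x.2 = some y.2) := by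
    ext x y
    refine and_congr_right fun hU => and_congr_right fun hG => ?_
    have : step ω x.1 y.1 x.2 = step ω' x.1 y.1 x.2 :=
      hdep x.1 y.1 x.2 hG fun i (hi : base i = _) => h i (by rwa [← hi] at hU)
    rw [this]
  simp only [stepReach, Set.mem_ofPred_eq, this]

/-- Revealing an edge `{u, u'}` with `u ∈ A`: if it is open then `u'` may be added to `A`. -/
lemma bondReach_subset [DecidableEq (Sym2 V)] {U : Finset (Sym2 V)} {A T : Set V} {u u' : V}
    (hu : u ∈ A) :
    bondReach G U A T ⊆
      ({ω | (openGraph ω).Adj u u'} ∩ bondReach G (U.erase s(u, u')) (insert u' A) T) ∪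
      ({ω | (openGraph ω).Adj u u'}ᶜ ∩ bondReach G (U.erase s(u, u')) A T) := by
  rintro ω ⟨a, ha, b, hb, hab⟩
  by_cases ho : (openGraph ω).Adj u u'
  · refine Or.inl ⟨ho, ?_⟩
    suffices ∃ a ∈ insert u' A, Relation.ReflTransGen
        (fun x y => s(x, y) ∈ U.erase s(u, u') ∧ (openGraph ω).Adj x y) a b by
      obtain ⟨a, ha, h⟩ := this
      exact ⟨a, ha, b, hb, h⟩
    clear hb
    induction hab with
    | refl => exact ⟨a, Or.inr ha, .refl⟩
    | @tail x y _ hxy ih =>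
      obtain ⟨a', ha', h'⟩ := ih
      by_cases he : s(x, y) = s(u, u')
      · rcases Sym2.eq_iff.1 he with ⟨-, rfl⟩ | ⟨-, rfl⟩
        · exact ⟨y, Or.inl rfl, .refl⟩
        · exact ⟨y, Or.inr hu, .refl⟩
      · exact ⟨a', ha', h'.tail ⟨Finset.mem_erase.2 ⟨he, hxy.1⟩, hxy.2⟩⟩
  · refine Or.inr ⟨ho, a, ha, b, hb, reflTransGen_mono hab fun x y hxy => ⟨Finset.mem_erase.2 ⟨?_, hxy.1⟩, hxy.2⟩⟩
    intro he
    rcases Sym2.eq_iff.1 he with ⟨rfl, rfl⟩ | ⟨rfl, rfl⟩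
    · exact ho hxy.2
    · exact ho hxy.2.symm

lemma stepReach_mono {step : (I → Bool) → V → V → Y → Option Y} {U U' : Finset (Sym2 V)}
    (hU : U' ⊆ U) (H : Set (V × Y)) (T : Set V) :
    stepReach G step U' H T ⊆ stepReach G step U H T := by
  rintro ω ⟨a, ha, b, hb, hab⟩
  exact ⟨a, ha, b, hb, reflTransGen_mono hab fun x y hxy => ⟨hU hxy.1, hxy.2⟩⟩

lemma inter_stepReach_subset {step : (I → Bool) → V → V → Y → Option Y} {U U' : Finset (Sym2 V)}
    (hU : U' ⊆ U) {H : Set (V × Y)} {T : Set V} {u u' : V} {y y' : Y} (hu : (u, y) ∈ H)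
    (hG : G.Adj u u') (he : s(u, u') ∈ U) :
    {ω | step ω u u' y = some y'} ∩ stepReach G step U' (insert (u', y') H) T ⊆
      stepReach G step U H T := by
  rintro ω ⟨hs, a, ha, b, hb, hab⟩
  have hab' := reflTransGen_mono hab (p := fun x y => s(x.1, y.1) ∈ U ∧ G.Adj x.1 y.1 ∧
    step ω x.1 y.1 x.2 = some y.2) fun x y hxy => ⟨hU hxy.1, hxy.2⟩
  rcases ha with rfl | ha
  · exact ⟨(u, y), hu, b, hb, .head (b := (u', y')) ⟨he, hG, hs⟩ hab'⟩
  · exact ⟨a, ha, b, hb, hab'⟩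

variable [Countable V] [Countable Y] {μ : I → Measure Bool} [∀ i, IsProbabilityMeasure (μ i)]
  {base : I → Sym2 V} {step : (I → Bool) → V → V → Y → Option Y} {p : unitInterval}

/-- The exploration argument. The edges of a finite set are revealed one after another, always
choosing one that leaves the explored vertices; whatever the height reached so far, the edge is
crossed with probability `p`, independently of the edges revealed before. -/
lemma bondReach_le_stepReach
    (hmeas : ∀ u u' y o, MeasurableSet {ω | step ω u u' y = o})
    (hdep : ∀ u u' y, G.Adj u u' → DependsOn (fun ω => step ω u u' y) {i | base i = s(u, u')})
    (hprob : ∀ u u' y, G.Adj u u' →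
      Measure.infinitePi μ {ω | step ω u u' y = none} = ENNReal.ofReal (1 - p))
    (T : Set V) (U : Finset (Sym2 V)) (A : Set V) (H : Set (V × Y)) (hAH : A ⊆ Prod.fst '' H) :
    bondMeasure G (fun _ => p) (bondReach G U A T) ≤
      Measure.infinitePi μ (stepReach G step U H T) := by
  classical
  induction U using Finset.strongInduction generalizing A H with
  | H U ih =>
  by_cases hex : ∃ u ∈ A, ∃ u', u' ∉ A ∧ s(u, u') ∈ U ∧ G.Adj u u'
  · obtain ⟨u, hu, u', hu', he, hG⟩ := hex
    obtain ⟨⟨v, y⟩, huy, huv⟩ := hAH hu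
    obtain rfl : v = u := huv
    rename' v => u
    set U' := U.erase s(u, u') with hU'
    have hss : U' ⊂ U := Finset.erase_ssubset he
    set R := bondMeasure G (fun _ => p) (bondReach G U' A T) with hR
    set R' := bondMeasure G (fun _ => p) (bondReach G U' (insert u' A) T) with hR'
    -- The upper bound for Bernoulli percolation.
    have hopen : bondMeasure G (fun _ => p) {ω | (openGraph ω).Adj u u'} = ENNReal.ofReal p := by
      have := bondMeasure_forall_mem_list (G := G) (fun _ => p) id true (l := [⟨s(u, u'), hG⟩])
        (by simp)
      simp only [List.mem_singleton, forall_eq, id, List.map_cons, List.map_nil, List.prod_cons,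
        List.prod_nil, mul_one, bernoulli_true] at this
      rw [← this]
      congr 1
      ext ω
      exact ⟨fun ⟨_, h⟩ => h, fun h => ⟨hG, h⟩⟩
    have hclosed : bondMeasure G (fun _ => p) {ω | (openGraph ω).Adj u u'}ᶜ =
        ENNReal.ofReal (1 - p) := by
      rw [prob_compl_eq_one_sub (measurableSet_open _ _), hopen,
        ENNReal.ofReal_sub _ p.2.1, ENNReal.ofReal_one]
    have hdo : DependsOn (fun ω => ω ∈ {ω : Config G | (openGraph ω).Adj u u'})
        {e | (e : Sym2 V) = s(u, u')} := fun ω ω' h => propext <| exists_congr fun hG' => by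
      rw [h ⟨_, hG'⟩ rfl]
    have hdc : DependsOn (fun ω => ω ∈ {ω : Config G | (openGraph ω).Adj u u'}ᶜ)
        {e | (e : Sym2 V) = s(u, u')} := fun ω ω' h => congrArg Not (hdo h)
    have hdisj : Disjoint {e : G.edgeSet | (e : Sym2 V) = s(u, u')} {e | (e : Sym2 V) ∈ U'} := by
      rw [Set.disjoint_left]
      intro e (h1 : (e : Sym2 V) = _) (h2 : (e : Sym2 V) ∈ U')
      rw [h1] at h2
      exact Finset.notMem_erase _ _ h2
    have hup : bondMeasure G (fun _ => p) (bondReach G U A T) ≤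
        ENNReal.ofReal p * R' + ENNReal.ofReal (1 - p) * R := by
      refine (measure_mono (bondReach_subset (u' := u') hu)).trans
        ((measure_union_le _ _).trans (le_of_eq ?_))
      congr 1
      · rw [hR', ← hopen]
        exact infinitePi_inter_eq_mul _ (measurableSet_open _ _) (measurableSet_bondReach _ _ _)
          hdo (dependsOn_bondReach _ _ _) hdisj
      · rw [hR, ← hclosed]
        exact infinitePi_inter_eq_mul _ (measurableSet_open _ _).compl
          (measurableSet_bondReach _ _ _) hdc (dependsOn_bondReach _ _ _) hdisj
    -- The lower bound for the exploration.
    have hmul : ∀ (o : Option Y) (H' : Set (V × Y)),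
        Measure.infinitePi μ ({ω | step ω u u' y = o} ∩ stepReach G step U' H' T) =
        Measure.infinitePi μ {ω | step ω u u' y = o} *
          Measure.infinitePi μ (stepReach G step U' H' T) := by
      intro o H'
      refine infinitePi_inter_eq_mul (S := {i | base i = s(u, u')}) (T := {i | base i ∈ U'})
        μ (hmeas _ _ _ _) (measurableSet_stepReach hmeas _ _ _)
        (fun ω ω' h => congrArg (· = o) (hdep u u' y hG h)) (dependsOn_stepReach hdep _ _ _) ?_
      rw [Set.disjoint_left]
      intro i (h1 : base i = _) (h2 : base i ∈ U')
      rw [h1] at h2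
      exact Finset.notMem_erase _ _ h2
    have hnone : ENNReal.ofReal (1 - p) * R ≤
        Measure.infinitePi μ (stepReach G step U H T ∩ {ω | step ω u u' y = none}) := by
      calc ENNReal.ofReal (1 - p) * R
          ≤ Measure.infinitePi μ {ω | step ω u u' y = none} *
              Measure.infinitePi μ (stepReach G step U' H T) := by
            rw [hprob u u' y hG]; gcongr; exact ih U' hss A H hAH
        _ = Measure.infinitePi μ ({ω | step ω u u' y = none} ∩ stepReach G step U' H T) :=
            (hmul _ _).symm
        _ ≤ _ := by
            refine measure_mono ?_
            rintro ω ⟨h1, h2⟩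
            exact ⟨stepReach_mono hss.subset _ _ h2, h1⟩
    have hsome : ENNReal.ofReal p * R' ≤
        Measure.infinitePi μ (stepReach G step U H T \ {ω | step ω u u' y = none}) := by
      have hpos : ENNReal.ofReal p = ∑' y', Measure.infinitePi μ {ω | step ω u u' y = some y'} := by
        rw [← measure_iUnion _ fun y' => hmeas _ _ _ _]
        · have : ⋃ y', {ω | step ω u u' y = some y'} = {ω | step ω u u' y = none}ᶜ := by
            ext ω
            simp [Option.ne_none_iff_exists']
          rw [this, prob_compl_eq_one_sub (hmeas _ _ _ _), hprob u u' y hG, ← ENNReal.ofReal_one,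
            ← ENNReal.ofReal_sub _ (sub_nonneg.2 p.2.2), sub_sub_cancel]
        · intro y₁ y₂ hne
          refine Set.disjoint_left.2 fun ω (h1 : _ = _) (h2 : _ = _) => hne ?_
          exact Option.some_injective _ (h1.symm.trans h2)
      calc ENNReal.ofReal p * R'
          ≤ ∑' y', Measure.infinitePi μ {ω | step ω u u' y = some y'} *
              Measure.infinitePi μ (stepReach G step U' (insert (u', y') H) T) := by
            rw [hpos, ← ENNReal.tsum_mul_right]
            refine ENNReal.tsum_le_tsum fun y' => ?_
            gcongr
            refine ih U' hss _ _ ?_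
            rw [Set.image_insert_eq]
            exact Set.insert_subset_insert hAH
        _ = Measure.infinitePi μ (⋃ y', {ω | step ω u u' y = some y'} ∩
              stepReach G step U' (insert (u', y') H) T) := by
            rw [measure_iUnion _ fun y' => (hmeas _ _ _ _).inter (measurableSet_stepReach hmeas _ _ _)]
            · exact tsum_congr fun y' => (hmul _ _).symm
            · intro y₁ y₂ hne
              refine Set.disjoint_left.2 fun ω h1 h2 => hne ?_
              have h1' : step ω u u' y = some y₁ := h1.1
              have h2' : step ω u u' y = some y₂ := h2.1
              exact Option.some_injective _ (h1'.symm.trans h2')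
        _ ≤ _ := by
            refine measure_mono (Set.iUnion_subset fun y' ω hω =>
              ⟨inter_stepReach_subset hss.subset huy hG he hω, fun h => ?_⟩)
            have h1 : step ω u u' y = some y' := hω.1
            have h2 : step ω u u' y = none := h
            simp [h1] at h2
    calc _ ≤ ENNReal.ofReal p * R' + ENNReal.ofReal (1 - p) * R := hup
      _ ≤ _ := add_le_add hsome hnone
      _ = _ := by rw [add_comm]; exact measure_inter_add_sdiff _ (hmeas _ _ _ _)
  · -- No edge of `U` leaves `A`.
    push Not at hex
    by_cases hAT : ∃ a ∈ A, a ∈ T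
    · obtain ⟨a, ha, haT⟩ := hAT
      obtain ⟨b, hb, rfl⟩ := hAH ha
      have : stepReach G step U H T = Set.univ :=
        Set.eq_univ_of_forall fun ω => ⟨b, hb, b, haT, .refl⟩
      rw [this, measure_univ]
      exact prob_le_one
    · have : bondReach G U A T = ∅ := by
        refine Set.eq_empty_of_forall_notMem ?_
        rintro ω ⟨a, ha, b, hb, hab⟩
        refine hAT ⟨b, ?_, hb⟩
        clear hb
        induction hab with
        | refl => exact ha
        | tail _ hxy ih =>
          by_contra hy
          exact hex _ ih _ hy hxy.1 hxy.2.1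
      rw [this, measure_empty]
      exact zero_le

/-- The exploration reaches infinitely many vertices at least as likely as the Bernoulli cluster
is infinite. -/
lemma measure_infinite_le_exploration
    (hmeas : ∀ u u' y o, MeasurableSet {ω | step ω u u' y = o})
    (hdep : ∀ u u' y, G.Adj u u' → DependsOn (fun ω => step ω u u' y) {i | base i = s(u, u')})
    (hprob : ∀ u u' y, G.Adj u u' →
      Measure.infinitePi μ {ω | step ω u u' y = none} = ENNReal.ofReal (1 - p))
    (o : V) (y₀ : Y) :
    bondMeasure G (fun _ => p) {ω | (cluster ω o).Infinite} ≤
      Measure.infinitePi μ {ω | {b : V × Y | Relation.ReflTransGen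
        (fun x y : V × Y => G.Adj x.1 y.1 ∧ step ω x.1 y.1 x.2 = some y.2) (o, y₀) b}.Infinite} := by
  classical
  have : Countable (Sym2 V) := inferInstanceAs (Countable (Quot _))
  let E : Finset V → Set (I → Bool) := fun F =>
    ⋃ U, stepReach G step U {(o, y₀)} {v | v ∉ F}
  have hE : ∀ F, bondMeasure G (fun _ => p) {ω | (cluster ω o).Infinite} ≤
      Measure.infinitePi μ (E F) := by
    intro F
    have hsub : {ω : Config G | (cluster ω o).Infinite} ⊆
        ⋃ U, bondReach G U {o} {v | v ∉ F} := by
      intro ω hω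
      obtain ⟨b, hb, hbF⟩ := Set.Infinite.exists_notMem_finset hω F
      rw [mem_cluster_iff] at hb
      suffices ∃ U : Finset (Sym2 V), Relation.ReflTransGen
          (fun x y => s(x, y) ∈ U ∧ (openGraph ω).Adj x y) o b by
        obtain ⟨U, hU⟩ := this
        exact Set.mem_iUnion.2 ⟨U, o, rfl, b, hbF, hU⟩
      clear hbF
      induction hb with
      | refl => exact ⟨∅, .refl⟩
      | @tail x y _ hxy ih =>
        obtain ⟨U, hU⟩ := ih
        exact ⟨insert s(x, y) U, (reflTransGen_mono hU fun a b hab =>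
          ⟨Finset.mem_insert_of_mem hab.1, hab.2⟩).tail ⟨Finset.mem_insert_self _ _, hxy⟩⟩
    refine (measure_mono hsub).trans ?_
    rw [Directed.measure_iUnion]
    · refine iSup_le fun U => ?_
      refine (bondReach_le_stepReach hmeas hdep hprob _ U {o} {(o, y₀)} (by simp)).trans ?_
      exact measure_mono (Set.subset_iUnion (fun U => stepReach G step U {(o, y₀)} _) U)
    · refine Monotone.directed_le fun U U' hU ω => ?_
      rintro ⟨a, ha, b, hb, hab⟩
      exact ⟨a, ha, b, hb, reflTransGen_mono hab fun x y hxy => ⟨hU hxy.1, hxy.2⟩⟩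
  have hsub : ⋂ F, E F ⊆ {ω | {b : V × Y | Relation.ReflTransGen
      (fun x y : V × Y => G.Adj x.1 y.1 ∧ step ω x.1 y.1 x.2 = some y.2) (o, y₀) b}.Infinite} := by
    intro ω hω hfin
    obtain ⟨U, a, ha, b, hb, hab⟩ :=
      Set.mem_iUnion.1 (Set.mem_iInter.1 hω (hfin.image Prod.fst).toFinset)
    obtain rfl : a = (o, y₀) := ha
    refine hb ?_
    rw [Set.Finite.mem_toFinset]
    exact ⟨b, reflTransGen_mono hab fun x y hxy => hxy.2, rfl⟩
  refine le_trans ?_ (measure_mono hsub)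
  rw [Directed.measure_iInter]
  · exact le_iInf hE
  · exact fun F => (MeasurableSet.iUnion fun U =>
      measurableSet_stepReach hmeas U _ _).nullMeasurableSet
  · refine Antitone.directed_ge fun F F' hF ω hω => ?_
    obtain ⟨U, a, ha, b, hb, hab⟩ := Set.mem_iUnion.1 hω
    exact Set.mem_iUnion.2 ⟨U, a, ha, b, fun h => hb (hF h), hab⟩
  · exact ⟨∅, measure_ne_top _ _⟩

end Exploration

/-! ### Splitting edges into independent copies -/

section Split

lemma measurableSet_eq_true {I : Type*} (i : I) : MeasurableSet {ω : I → Bool | ω i = true} := by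
  have h : Measurable fun ω : I → Bool => ω i := measurable_pi_apply i
  exact h (measurableSet_singleton true)

variable {E L : Type*} [Fintype L]

/-- An edge is open if one of its copies, labelled by `L`, is open. -/
def mergeCopies (ω : E × L → Bool) (e : E) : Bool := decide (∃ l, ω (e, l) = true)

lemma measurable_mergeCopies : Measurable (mergeCopies : (E × L → Bool) → E → Bool) := by
  refine measurable_pi_lambda _ fun e => ?_
  refine (measurable_of_countable fun b : L → Bool => decide (∃ l, b l = true)).comp ?_
  exact measurable_pi_lambda _ fun l => measurable_pi_apply (e, l)

/-- If the copies of `e` are closed with probability `(1 - w e) ^ (1 / |L|)`, then `e` is open with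
probability `w e`. -/
lemma map_mergeCopies (w r : E → unitInterval)
    (hr : ∀ e, (1 - (r e : ℝ)) ^ Fintype.card L = 1 - w e) :
    (Measure.infinitePi fun i : E × L => bernoulliMeasure true false (r i.1)).map mergeCopies =
      Measure.infinitePi fun e => bernoulliMeasure true false (w e) := by
  let f : (L → Bool) → Bool := fun b => decide (∃ l, b l = true)
  have hf : Measurable f := measurable_of_countable f
  have h1 := Measure.infinitePi_map_curry (X := Bool)
    (fun (e : E) (_ : L) => bernoulliMeasure true false (r e))
  have h2 := Measure.infinitePi_map_pi
    (μ := fun e : E => Measure.infinitePi fun _ : L => bernoulliMeasure true false (r e))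
    (f := fun _ => f) (fun _ => hf)
  have h3 : ∀ e, (Measure.infinitePi fun _ : L => bernoulliMeasure true false (r e)).map f =
      bernoulliMeasure true false (w e) := by
    intro e
    have : IsProbabilityMeasure
        ((Measure.infinitePi fun _ : L => bernoulliMeasure true false (r e)).map f) :=
      Measure.isProbabilityMeasure_map hf.aemeasurable
    have hfalse : (Measure.infinitePi fun _ : L => bernoulliMeasure true false (r e)).map f {false} =
        ENNReal.ofReal (1 - w e) := by
      rw [Measure.map_apply hf (measurableSet_singleton _)]
      have hpre : f ⁻¹' {false} = Set.pi ((Finset.univ : Finset L) : Set L) fun _ => {false} := by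
        ext b; simp [f, Set.mem_pi]
      rw [hpre, Measure.infinitePi_pi _ fun _ _ => measurableSet_singleton _]
      simp only [bernoulli_false, Finset.prod_const, Finset.card_univ]
      rw [← ENNReal.ofReal_pow (sub_nonneg.2 (r e).2.2), hr]
    refine Measure.ext_of_singleton fun b => ?_
    cases b with
    | false => rw [hfalse, bernoulli_false]
    | true =>
      have hc : ({true} : Set Bool) = {false}ᶜ := by ext b; cases b <;> simp
      rw [hc, prob_compl_eq_one_sub (measurableSet_singleton _),
        prob_compl_eq_one_sub (measurableSet_singleton _), hfalse, bernoulli_false]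
  rw [← funext h3, ← h2, ← h1, Measure.map_map (by fun_prop) (by fun_prop)]
  rfl

/-- An edge that is open with probability `x` can be split into `n` independent copies which are
open with equal probability `r`. -/
lemma exists_one_sub_pow_eq {n : ℕ} (hn : n ≠ 0) (x : unitInterval) :
    ∃ r : unitInterval, (1 - (r : ℝ)) ^ n = 1 - x := by
  have h0 : 0 ≤ 1 - (x : ℝ) := sub_nonneg.2 x.2.2
  have h1 : 1 - (x : ℝ) ≤ 1 := by linarith [x.2.1]
  refine ⟨⟨1 - (1 - (x : ℝ)) ^ ((n : ℝ)⁻¹), ?_, ?_⟩, ?_⟩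
  · exact sub_nonneg.2 (Real.rpow_le_one h0 h1 (by positivity))
  · linarith [Real.rpow_nonneg h0 (n : ℝ)⁻¹]
  · simpa using Real.rpow_inv_natCast_pow h0 hn

/-- Bernoulli's inequality: a copy is open with probability at least `x / n`. -/
lemma le_mul_of_one_sub_pow_eq {n : ℕ} {x r : unitInterval}
    (h : (1 - (r : ℝ)) ^ n = 1 - x) : (x : ℝ) ≤ n * r := by
  have := one_add_mul_le_pow (a := -(r : ℝ)) (by linarith [r.2.2]) n
  rw [← sub_eq_add_neg 1 (r : ℝ), h] at this
  linarith

end Split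

/-! ### The exploration of the product lattice -/

section Product

variable {d s : ℕ}

lemma first_adj {u u' : Fin d → ℤ} (h : (lattice d).Adj u u') (y : Fin s → ℤ) :
    (prodLattice d s).Adj (u, y) (u', y) := Or.inl ⟨h, rfl⟩

/-- The edge of `ℤ^d` in whose exploration a given copy of an edge of the product is used. -/
def baseEdge (i : (prodLattice d s).edgeSet × (Fin d × Bool)) : Sym2 (Fin d → ℤ) :=
  Sym2.lift ⟨fun a b : (Fin d → ℤ) × (Fin s → ℤ) =>
    if a.1 = b.1 then s(a.1, a.1 + unitVec i.2) else s(a.1, b.1), fun a b => by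
      by_cases h : a.1 = b.1
      · simp [h]
      · simp [h, Ne.symm h, Sym2.eq_swap]⟩ (i.1 : Sym2 _)

lemma measurableSet_merged_adj (x y : (Fin d → ℤ) × (Fin s → ℤ)) :
    MeasurableSet {ω : (prodLattice d s).edgeSet × (Fin d × Bool) → Bool |
      (openGraph (mergeCopies ω)).Adj x y} :=
  measurable_mergeCopies (measurableSet_open x y)

lemma dependsOn_merged_adj {x y : (Fin d → ℤ) × (Fin s → ℤ)} (h : (prodLattice d s).Adj x y) :
    DependsOn (fun ω : (prodLattice d s).edgeSet × (Fin d × Bool) → Bool =>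
      (openGraph (mergeCopies ω)).Adj x y) {i | i.1 = ⟨s(x, y), h⟩} := by
  intro ω ω' hω
  refine propext (exists_congr fun h' => ?_)
  have : mergeCopies ω ⟨s(x, y), h'⟩ = mergeCopies ω' ⟨s(x, y), h'⟩ :=
    decide_eq_decide.2 (exists_congr fun l => by rw [hω (⟨s(x, y), h'⟩, l) rfl])
  rw [this]

variable [NeZero d] [NeZero s]

/-- The vertical edge from `(u, y)` upwards in the first coordinate direction of `ℤ^s`. -/
def upEdge (u : Fin d → ℤ) (y : Fin s → ℤ) : (prodLattice d s).edgeSet :=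
  ⟨s((u, y), (u, y + unitVec (0, true))), Or.inr ⟨lattice_adj_add_unitVec _ _, rfl⟩⟩

/-- The direction of a unit vector. -/
noncomputable def label (z : Fin d → ℤ) : Fin d × Bool := Function.invFun unitVec z

lemma add_unitVec_label {u u' : Fin d → ℤ} (h : (lattice d).Adj u u') :
    u + unitVec (label (u' - u)) = u' := by
  obtain ⟨l, rfl⟩ := exists_eq_add_unitVec h
  rw [add_sub_cancel_left, label, Function.invFun_eq (f := unitVec) ⟨l, rfl⟩]

open Classical in
/-- The attempt to cross the edge from `u` to `u'` at height `y`. If the edge at height `y` is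
closed, then the copy of the vertical edge above `(u, y)` that is reserved for the direction from
`u` to `u'`, followed by the edge at the height above, is tried. -/
noncomputable def crossing (ω : (prodLattice d s).edgeSet × (Fin d × Bool) → Bool)
    (u u' : Fin d → ℤ) (y : Fin s → ℤ) : Option (Fin s → ℤ) :=
  if (openGraph (mergeCopies ω)).Adj (u, y) (u', y) then some y
  else if ω (upEdge u y, label (u' - u)) = true ∧
      (openGraph (mergeCopies ω)).Adj (u, y + unitVec (0, true)) (u', y + unitVec (0, true))
    then some (y + unitVec (0, true))
  else none

lemma measurableSet_crossing (u u' : Fin d → ℤ) (y : Fin s → ℤ) (o : Option (Fin s → ℤ)) :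
    MeasurableSet {ω : (prodLattice d s).edgeSet × (Fin d × Bool) → Bool |
      crossing ω u u' y = o} := by
  have hB : MeasurableSet {ω : (prodLattice d s).edgeSet × (Fin d × Bool) → Bool |
      ω (upEdge u y, label (u' - u)) = true} :=
    measurableSet_eq_true _
  have hA := measurableSet_merged_adj (u, y) (u', y)
  have hC := measurableSet_merged_adj (u, y + unitVec (0, true)) (u', y + unitVec (0, true))
  have := (hA.inter (.const (some y = o))).union
    ((hA.compl.inter ((hB.inter hC).inter (.const (some (y + unitVec (0, true)) = o)))).union
    (hA.compl.inter ((hB.inter hC).compl.inter (.const (none = o)))))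
  convert this using 1
  ext ω
  simp only [crossing, Set.mem_ofPred_eq, Set.mem_union, Set.mem_inter_iff, Set.mem_compl_iff]
  split_ifs <;> simp_all

lemma dependsOn_crossing {u u' : Fin d → ℤ} (y : Fin s → ℤ) (h : (lattice d).Adj u u') :
    DependsOn (fun ω : (prodLattice d s).edgeSet × (Fin d × Bool) → Bool => crossing ω u u' y)
      {i | baseEdge i = s(u, u')} := by
  have hbase : ∀ (y : Fin s → ℤ) (i : (prodLattice d s).edgeSet × (Fin d × Bool)),
      i.1 = ⟨s((u, y), (u', y)), first_adj h y⟩ → baseEdge i = s(u, u') := by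
    rintro y ⟨_, l⟩ rfl
    simp [baseEdge, h.ne]
  intro ω ω' hω
  have h1 : ∀ y, (openGraph (mergeCopies ω)).Adj (u, y) (u', y) =
      (openGraph (mergeCopies ω')).Adj (u, y) (u', y) := fun y =>
    dependsOn_merged_adj (first_adj h y) fun i hi => hω i (hbase y i hi)
  have h2 : ω (upEdge u y, label (u' - u)) = ω' (upEdge u y, label (u' - u)) := by
    refine hω _ ?_
    change baseEdge _ = _
    simp [baseEdge, upEdge, add_unitVec_label h]
  simp only [crossing]
  classical exact if_congr (Iff.of_eq (h1 y)) rfl (if_congr (by rw [h2, h1]) rfl rfl)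

lemma reachable_of_crossing {ω : (prodLattice d s).edgeSet × (Fin d × Bool) → Bool}
    {u u' : Fin d → ℤ} {y y' : Fin s → ℤ} (h : crossing ω u u' y = some y') :
    (openGraph (mergeCopies ω)).Reachable (u, y) (u', y') := by
  unfold crossing at h
  split_ifs at h with h1 h2
  · cases h; exact h1.reachable
  · cases h
    refine SimpleGraph.Reachable.trans (SimpleGraph.Adj.reachable ?_) h2.2.reachable
    exact ⟨(upEdge u y).2, decide_eq_true ⟨_, h2.1⟩⟩

/-- With `p` the probability of a horizontal edge and `t` that of a copy of a vertical edge, an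
attempted crossing fails with probability `(1 - p) (1 - t p)`, whatever the height. -/
lemma measure_crossing_eq_none {p t : unitInterval}
    {w r : (prodLattice d s).edgeSet → unitInterval}
    (hw : ∀ e, IsFirstEdge e → w e = p) (hrt : ∀ e, ¬ IsFirstEdge e → r e = t)
    (hr : ∀ e, (1 - (r e : ℝ)) ^ Fintype.card (Fin d × Bool) = 1 - w e)
    {u u' : Fin d → ℤ} (y : Fin s → ℤ) (h : (lattice d).Adj u u') :
    (Measure.infinitePi fun i : (prodLattice d s).edgeSet × (Fin d × Bool) =>
      bernoulliMeasure true false (r i.1)) {ω | crossing ω u u' y = none} =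
      ENNReal.ofReal ((1 - p) * (1 - t * p)) := by
  set P := Measure.infinitePi fun i : (prodLattice d s).edgeSet × (Fin d × Bool) =>
    bernoulliMeasure true false (r i.1) with hP
  let A : (Fin s → ℤ) → Set ((prodLattice d s).edgeSet × (Fin d × Bool) → Bool) := fun y =>
    {ω | (openGraph (mergeCopies ω)).Adj (u, y) (u', y)}
  let B : Set ((prodLattice d s).edgeSet × (Fin d × Bool) → Bool) :=
    {ω | ω (upEdge u y, label (u' - u)) = true}
  have hA : ∀ y, P (A y) = ENNReal.ofReal p := by
    intro y
    have h1 : P (A y) = P.map mergeCopies {ω | (openGraph ω).Adj (u, y) (u', y)} :=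
      (Measure.map_apply measurable_mergeCopies (measurableSet_open _ _)).symm
    have h2 := bondMeasure_forall_mem_list (G := prodLattice d s) w id true
      (l := [⟨s((u, y), (u', y)), first_adj h y⟩]) (by simp)
    simp only [List.mem_singleton, forall_eq, id, List.map_cons, List.map_nil, List.prod_cons,
      List.prod_nil, mul_one, bernoulli_true] at h2
    rw [hw ⟨s((u, y), (u', y)), first_adj h y⟩ ⟨u, u', y, rfl⟩] at h2
    rw [h1, hP, map_mergeCopies w r hr, ← h2, bondMeasure]
    congr 1
    ext ω
    exact ⟨fun ⟨_, h⟩ => h, fun h' => ⟨first_adj h y, h'⟩⟩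
  have hBm : MeasurableSet B := measurableSet_eq_true _
  have hB : P B = ENNReal.ofReal t := by
    have hBset : B = Set.pi (({(upEdge u y, label (u' - u))} : Finset _) : Set _)
        fun _ => {true} := by
      ext ω; simp [B]
    rw [hBset, hP, Measure.infinitePi_pi _ fun _ _ => measurableSet_singleton _,
      Finset.prod_singleton, bernoulli_true, hrt]
    rintro ⟨v, v', z, hv⟩
    simp only [upEdge, Sym2.eq_iff, Prod.mk.injEq] at hv
    have hne : y + unitVec (0, true) ≠ y := fun h0 =>
      (lattice_adj_add_unitVec y (0, true)).ne h0.symm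
    rcases hv with ⟨⟨-, h1⟩, -, h2⟩ | ⟨⟨-, h1⟩, -, h2⟩ <;> exact hne (h2.trans h1.symm)
  have hne : ∀ z : Fin s → ℤ, (⟨s((u, z), (u', z)), first_adj h z⟩ : (prodLattice d s).edgeSet) ≠
      upEdge u y := by
    intro z hz
    have hz' := congrArg Subtype.val hz
    simp only [upEdge, Sym2.eq_iff, Prod.mk.injEq] at hz'
    rcases hz' with ⟨-, h1, -⟩ | ⟨-, h1, -⟩ <;> exact h.ne h1.symm
  have hne' : (⟨s((u, y), (u', y)), first_adj h y⟩ : (prodLattice d s).edgeSet) ≠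
      ⟨s((u, y + unitVec (0, true)), (u', y + unitVec (0, true))), first_adj h _⟩ := by
    intro hz
    have hz' := congrArg Subtype.val hz
    simp only [Sym2.eq_iff, Prod.mk.injEq] at hz'
    have hne : y ≠ y + unitVec (0, true) := (lattice_adj_add_unitVec y (0, true)).ne
    rcases hz' with ⟨⟨-, h1⟩, -⟩ | ⟨⟨-, h1⟩, -⟩ <;> exact hne h1
  have hBdep : DependsOn (fun ω => ω ∈ B) {i | i.1 = upEdge u y} := fun ω ω' hω => by
    change (ω _ = true) = (ω' _ = true)
    rw [hω (upEdge u y, label (u' - u)) rfl]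
  have hAdep : ∀ y, DependsOn (fun ω => ω ∈ A y)
      {i | i.1 = (⟨s((u, y), (u', y)), first_adj h y⟩ : (prodLattice d s).edgeSet)} := fun y =>
    dependsOn_merged_adj (first_adj h y)
  have hBA : P (B ∩ A (y + unitVec (0, true))) = ENNReal.ofReal (t * p) := by
    rw [hP, infinitePi_inter_eq_mul _ hBm (measurableSet_merged_adj _ _) hBdep (hAdep _), ← hP, hB,
      hA, ENNReal.ofReal_mul t.2.1]
    rw [Set.disjoint_left]
    intro i (h1 : i.1 = _) (h2 : i.1 = _)
    exact hne _ (h2.symm.trans h1)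
  have hset : {ω | crossing ω u u' y = none} = (A y)ᶜ ∩ (B ∩ A (y + unitVec (0, true)))ᶜ := by
    ext ω
    simp only [crossing, A, B, Set.mem_ofPred_eq, Set.mem_inter_iff, Set.mem_compl_iff]
    split_ifs with h1 h2 <;> simp_all
  have hBAm : MeasurableSet (B ∩ A (y + unitVec (0, true))) :=
    hBm.inter (measurableSet_merged_adj _ _)
  have h1 : P (A y)ᶜ = ENNReal.ofReal (1 - p) := by
    rw [prob_compl_eq_one_sub (measurableSet_merged_adj _ _), hA, ENNReal.ofReal_sub _ p.2.1,
      ENNReal.ofReal_one]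
  have h2 : P (B ∩ A (y + unitVec (0, true)))ᶜ = ENNReal.ofReal (1 - t * p) := by
    rw [prob_compl_eq_one_sub hBAm, hBA, ENNReal.ofReal_sub _ (mul_nonneg t.2.1 p.2.1),
      ENNReal.ofReal_one]
  rw [hset, ENNReal.ofReal_mul (sub_nonneg.2 p.2.2), ← h1, ← h2]
  refine infinitePi_inter_eq_mul _ (measurableSet_merged_adj _ _).compl hBAm.compl
    (S := {i | i.1 = (⟨s((u, y), (u', y)), first_adj h y⟩ : (prodLattice d s).edgeSet)})
    (T := {i | i.1 = (⟨s((u, y), (u', y)), first_adj h y⟩ : (prodLattice d s).edgeSet)}ᶜ)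
    (fun ω ω' hω => congrArg Not (hAdep y hω)) (fun ω ω' hω => ?_) disjoint_compl_right
  have e1 : (ω ∈ B) = (ω' ∈ B) :=
    hBdep fun i (hi : i.1 = _) => hω i fun (hi' : i.1 = _) => hne y (hi'.symm.trans hi)
  have e2 : (ω ∈ A (y + unitVec (0, true))) = (ω' ∈ A (y + unitVec (0, true))) :=
    hAdep _ fun i (hi : i.1 = _) => hω i fun (hi' : i.1 = _) => hne' (hi'.symm.trans hi)
  simp only [Set.mem_compl_iff, Set.mem_inter_iff, e1, e2]

/-- Exploring the product lattice along its projection to `ℤ^d` dominates a homogeneous percolation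
on `ℤ^d` whose density exceeds `p` by `p (1 - p) q / (2d)`. -/
lemma exists_theta_le_anisoTheta (p q : unitInterval) :
    ∃ p' : unitInterval, (p : ℝ) + (1 - p) * p * q / (2 * d) ≤ p' ∧
      theta d p' ≤ anisoTheta d s p q := by
  classical
  have hcard : Fintype.card (Fin d × Bool) = 2 * d := by simp [mul_comm]
  have hcard0 : Fintype.card (Fin d × Bool) ≠ 0 := Fintype.card_ne_zero
  choose copy hcopy using exists_one_sub_pow_eq hcard0
  let w : (prodLattice d s).edgeSet → unitInterval := fun e => if IsFirstEdge e then p else q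
  let r : (prodLattice d s).edgeSet → unitInterval := fun e => copy (w e)
  have hq : (q : ℝ) ≤ (2 * d) * copy q := by
    have := le_mul_of_one_sub_pow_eq (hcopy q)
    rw [hcard] at this
    exact_mod_cast this
  have h1 : 0 ≤ 1 - (p : ℝ) := sub_nonneg.2 p.2.2
  have h2 : 0 ≤ 1 - (copy q : ℝ) * p := by nlinarith [p.2.1, p.2.2, (copy q).2.1, (copy q).2.2]
  have h3 : (1 - (p : ℝ)) * (1 - copy q * p) ≤ 1 := by
    have : 0 ≤ (copy q : ℝ) * p := mul_nonneg (copy q).2.1 p.2.1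
    nlinarith [p.2.1]
  refine ⟨⟨1 - (1 - p) * (1 - copy q * p), sub_nonneg.2 h3, by linarith [mul_nonneg h1 h2]⟩, ?_, ?_⟩
  · have hd : (0 : ℝ) < 2 * d := by
      have : 0 < d := NeZero.pos d
      positivity
    have : (q : ℝ) / (2 * d) ≤ copy q := by rwa [div_le_iff₀' hd]
    have := mul_le_mul_of_nonneg_left this (mul_nonneg h1 p.2.1)
    rw [mul_div_assoc]
    simp only
    linarith
  · have hle := measure_infinite_le_exploration (G := lattice d)
      (μ := fun i : (prodLattice d s).edgeSet × (Fin d × Bool) =>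
        bernoulliMeasure true false (r i.1))
      (base := baseEdge) (step := crossing)
      (p := ⟨1 - (1 - p) * (1 - copy q * p), sub_nonneg.2 h3, by linarith [mul_nonneg h1 h2]⟩)
      measurableSet_crossing (fun u u' y h => dependsOn_crossing y h) (fun u u' y h => by
        rw [measure_crossing_eq_none (p := p) (t := copy q) (w := w) (r := r)
          (fun e he => if_pos he) (fun e he => congrArg copy (if_neg he)) (fun e => hcopy (w e)) y h]
        simp only [sub_sub_cancel])
      (0 : Fin d → ℤ) (0 : Fin s → ℤ)
    refine hle.trans ?_
    have hmap := map_mergeCopies (L := Fin d × Bool) w r fun e => hcopy (w e)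
    have : anisoTheta d s p q = (Measure.infinitePi fun i : (prodLattice d s).edgeSet ×
        (Fin d × Bool) => bernoulliMeasure true false (r i.1))
        (mergeCopies ⁻¹' {ω | (cluster ω 0).Infinite}) := by
      rw [← Measure.map_apply measurable_mergeCopies (measurableSet_infinite _), hmap]
      rfl
    rw [this]
    refine measure_mono fun ω hω => Set.Infinite.mono (fun b hb => ?_) hω
    have hb' : Relation.ReflTransGen (fun x y : (Fin d → ℤ) × (Fin s → ℤ) =>
      (lattice d).Adj x.1 y.1 ∧ crossing ω x.1 y.1 x.2 = some y.2) (0, 0) b := hb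
    clear hb
    induction hb' with
    | refl => exact SimpleGraph.Reachable.refl _
    | tail _ hxy ih => exact SimpleGraph.Reachable.trans ih (reachable_of_crossing hxy.2)

end Product

/-! ### Planar sublattices -/

section Planar

lemma lattice_adj_of_single {n : ℕ} {x y : Fin n → ℤ} (i : Fin n) (hi : |x i - y i| = 1)
    (hj : ∀ j, j ≠ i → x j = y j) : (lattice n).Adj x y := by
  change ∑ j, |x j - y j| = 1
  rw [Finset.sum_eq_single i (fun j _ h => by rw [hj j h]; simp) (by simp), hi]

lemma abs_dir_fst_of_horizontal {d : Fin 4} (hd : d = 0 ∨ d = 2) :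
    |(dir d).1| = 1 ∧ (dir d).2 = 0 := by
  rcases hd with rfl | rfl <;> exact ⟨rfl, rfl⟩

lemma abs_dir_snd_of_vertical {d : Fin 4} (hd : d = 1 ∨ d = 3) :
    (dir d).1 = 0 ∧ |(dir d).2| = 1 := by
  rcases hd with rfl | rfl <;> exact ⟨rfl, rfl⟩

lemma horizontal_or_vertical (d : Fin 4) : (d = 0 ∨ d = 2) ∨ (d = 1 ∨ d = 3) := by
  revert d; decide

/-- The critical threshold is at most `2/3` in dimension at least two. -/
lemma pc_le_two_thirds {d : ℕ} (hd : 2 ≤ d) : pc d ≤ 2 / 3 := by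
  refine Real.sSup_le ?_ (by norm_num)
  rintro _ ⟨p, rfl, hp⟩
  by_contra! hlt
  let i : Fin d := ⟨0, by omega⟩
  let j : Fin d := ⟨1, by omega⟩
  have hij : i ≠ j := by simp [i, j]
  let φ : ℤ × ℤ → Fin d → ℤ := fun z k => if k = i then z.1 else if k = j then z.2 else 0
  have hφi : ∀ z, φ z i = z.1 := fun z => if_pos rfl
  have hφj : ∀ z, φ z j = z.2 := fun z => (if_neg hij.symm).trans (if_pos rfl)
  have hφk : ∀ z k, k ≠ i → k ≠ j → φ z k = 0 := fun z k h h' => (if_neg h).trans (if_neg h')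
  have hφ : ∀ a e, (lattice d).Adj (φ a) (φ (a + dir e)) := by
    intro a e
    rcases horizontal_or_vertical e with he | he
    · obtain ⟨h1, h2⟩ := abs_dir_fst_of_horizontal he
      refine lattice_adj_of_single i (by simpa [hφi] using h1) fun k hk => ?_
      by_cases hkj : k = j
      · subst hkj; simp [hφj, h2]
      · simp only [hφk _ k hk hkj]
    · obtain ⟨h1, h2⟩ := abs_dir_snd_of_vertical he
      refine lattice_adj_of_single j (by simpa [hφj] using h2) fun k hk => ?_
      by_cases hki : k = i
      · subst hki; simp [hφi, h1]
      · simp only [hφk _ k hki hk]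
  have hinj : Function.Injective φ := fun z z' h =>
    Prod.ext (by rw [← hφi, h, hφi]) (by rw [← hφj, h, hφj])
  have h0 : 0 ≤ 1 - (p : ℝ) := sub_nonneg.2 p.2.2
  refine theta_ne_zero_of_ae p (ae_exists_infinite_of_peierls (fun _ => p) hφ hinj
    (α := 1 - p) (β := 1 - p) (c := 1) (r := 3 * (1 - p)) h0 h0 le_rfl (by linarith)
    (fun _ _ _ => le_rfl) (fun _ _ _ => le_rfl) (by linarith) (by linarith)) hp

/-- Percolation in a planar sublattice of the product lattice, with one horizontal and one vertical
direction, when `1 - p` is small compared to `q`. -/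
lemma ae_exists_infinite_of_mul_one_sub_le {d s : ℕ} [NeZero d] [NeZero s] {p q : unitInterval}
    (hp : (p : ℝ) < 1) (hq : 8 * (1 - (p : ℝ)) ≤ q) :
    ∀ᵐ ω ∂(anisoMeasure d s p q), ∃ x, (cluster ω x).Infinite := by
  classical
  let φ : ℤ × ℤ → (Fin d → ℤ) × (Fin s → ℤ) := fun z => (Pi.single 0 z.1, Pi.single 0 z.2)
  have hφ : ∀ a e, (prodLattice d s).Adj (φ a) (φ (a + dir e)) := by
    intro a e
    rcases horizontal_or_vertical e with he | he
    · obtain ⟨h1, h2⟩ := abs_dir_fst_of_horizontal he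
      refine Or.inl ⟨lattice_adj_of_single 0 (by simpa [φ] using h1) fun k hk => ?_, ?_⟩
      · simp [φ, hk]
      · simp [φ, h2]
    · obtain ⟨h1, h2⟩ := abs_dir_snd_of_vertical he
      refine Or.inr ⟨lattice_adj_of_single 0 (by simpa [φ] using h2) fun k hk => ?_, ?_⟩
      · simp [φ, hk]
      · simp [φ, h1]
  have hinj : Function.Injective φ := fun z z' h =>
    Prod.ext (Pi.single_injective _ (congrArg Prod.fst h))
      (Pi.single_injective _ (congrArg Prod.snd h))
  have h0 : 0 ≤ 1 - (p : ℝ) := sub_nonneg.2 p.2.2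
  have h0' : 0 ≤ 1 - (q : ℝ) := sub_nonneg.2 q.2.2
  -- With `δ = 1 - p`, horizontal edges get weight `3` and contours decay at rate `1 - 2δ`.
  refine ae_exists_infinite_of_peierls _ hφ hinj (α := 1 - p) (β := 1 - q) (c := 3)
    (r := 1 - 2 * (1 - p)) h0 h0' (by norm_num) (by linarith) (fun a e he => ?_)
    (fun a e he => ?_) (by linarith) (by linarith)
  · have : IsFirstEdge (dartEdge hφ (a, e)) := by
      refine ⟨(φ a).1, (φ (a + dir e)).1, (φ a).2, ?_⟩
      have : φ (a + dir e) = ((φ (a + dir e)).1, (φ a).2) := by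
        simp [φ, (abs_dir_fst_of_horizontal he).2]
      exact congrArg (fun x => s(φ a, x)) this
    rw [if_pos this]
  · have : ¬ IsFirstEdge (dartEdge hφ (a, e)) := by
      rintro ⟨u, u', v, h⟩
      have h2 : (φ a).2 = (φ (a + dir e)).2 := by
        rcases Sym2.eq_iff.1 h with ⟨h1, h2⟩ | ⟨h1, h2⟩ <;> rw [h1, h2]
      have h3 := Pi.single_injective (0 : Fin s) h2
      have h4 := (abs_dir_snd_of_vertical he).2
      simp only [Prod.snd_add, left_eq_add] at h3
      simp [h3] at h4
    rw [if_neg this]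

end Planar

/-! ### The main result -/

section Main

lemma pc_one : pc 1 = 1 :=
  le_antisymm (pc_le_one 1) (by simpa using inv_le_pc (d := 1) le_rfl)

/-- The increase of density by a vertical detour near the critical point exceeds the deficit. -/
lemma one_lt_four_mul_pc {d : ℕ} (hd : 2 ≤ d) : 1 < 4 * (d : ℝ) * (pc d * (1 - pc d)) := by
  have h1 := inv_le_pc (d := d) (by omega)
  have h2 := pc_le_two_thirds hd
  have hd' : (2 : ℝ) ≤ d := by exact_mod_cast hd
  have hcast : ((2 * d - 1 : ℕ) : ℝ) = 2 * d - 1 := by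
    rw [Nat.cast_sub (by omega)]; push_cast; ring
  rw [hcast, inv_le_iff_one_le_mul₀ (by linarith)] at h1
  rcases le_total (pc d) (1 / 2) with h | h
  · have hpos : 0 < pc d := by nlinarith
    nlinarith [mul_nonneg (mul_nonneg hpos.le (by linarith : (0 : ℝ) ≤ d))
      (by linarith : 0 ≤ 1 - 2 * pc d)]
  · nlinarith [mul_nonneg (by linarith : 0 ≤ pc d - 1 / 2) (by linarith : 0 ≤ 2 / 3 - pc d)]

/-- For `d = 1` the threshold is `1` and the Peierls argument applies; for `d ≥ 2` the exploration
dominates supercritical percolation on `ℤ^d`. -/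
lemma exists_forall_ae_exists_infinite (d : ℕ) (hd : 1 ≤ d) :
    ∃ ε : ℝ, 0 < ε ∧ ∀ s : ℕ, 1 ≤ s → ∀ p : unitInterval,
      0 < pc d - (p : ℝ) → pc d - (p : ℝ) < ε →
        ∀ q : unitInterval, 8 * (d : ℝ) ^ 2 * (pc d - (p : ℝ)) ≤ (q : ℝ) →
          ∀ᵐ ω ∂(anisoMeasure d s p q), ∃ x, (cluster ω x).Infinite := by
  have : NeZero d := ⟨by omega⟩
  rcases hd.eq_or_lt with rfl | hd2
  · refine ⟨1, one_pos, fun s hs p hp _ q hq => ?_⟩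
    have : NeZero s := ⟨by omega⟩
    rw [pc_one] at hp hq
    exact ae_exists_infinite_of_mul_one_sub_le (by linarith) (by simpa using hq)
  · have hcont : ContinuousAt (fun x : ℝ => 4 * (d : ℝ) * (x * (1 - x))) (pc d) := by fun_prop
    obtain ⟨ε, hε, h⟩ := Metric.eventually_nhds_iff.1
      (hcont.eventually (lt_mem_nhds (one_lt_four_mul_pc hd2)))
    refine ⟨ε, hε, fun s hs p hp hpε q hq => ?_⟩
    have : NeZero s := ⟨by omega⟩
    have hgain : 1 < 4 * (d : ℝ) * (p * (1 - p)) := h (by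
      rw [Real.dist_eq, abs_sub_comm, abs_of_pos hp]; exact hpε)
    obtain ⟨p', hp', hle⟩ := exists_theta_le_anisoTheta (d := d) (s := s) p q
    refine ae_exists_infinite_of_ne_zero _ 0 fun h0 => ?_
    refine theta_ne_zero_of_pc_lt (d := d) (p := p') ?_ (le_antisymm (h0 ▸ hle) zero_le)
    refine lt_of_lt_of_le ?_ hp'
    have hdpos : (0 : ℝ) < d := by exact_mod_cast hd
    have h1 : 4 * (d : ℝ) * (pc d - p) ≤ q / (2 * d) := by
      rw [le_div_iff₀ (by positivity)]
      linarith
    have h2 : 0 ≤ (1 - (p : ℝ)) * p := mul_nonneg (sub_nonneg.2 p.2.2) p.2.1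
    have h3 := mul_le_mul_of_nonneg_left h1 h2
    have h4 := mul_lt_mul_of_pos_right hgain hp
    rw [mul_div_assoc]
    linarith

lemma qc_nonneg (d s : ℕ) (p : unitInterval) : 0 ≤ qc d s p :=
  Real.sSup_nonneg (by rintro _ ⟨q, rfl, -⟩; exact q.2.1)

lemma neBot_comap_nhdsLT {a : ℝ} (h0 : 0 < a) (h1 : a ≤ 1) :
    (comap (fun p : unitInterval => (p : ℝ)) (𝓝[<] a)).NeBot := by
  refine comap_neBot fun t ht => ?_
  obtain ⟨l, hl, hlt⟩ := (mem_nhdsLT_iff_exists_Ioo_subset' h0).1 ht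
  obtain ⟨x, hx, hxa⟩ := exists_between (max_lt hl h0)
  exact ⟨⟨x, (le_max_right _ _).trans hx.le, hxa.le.trans h1⟩,
    hlt ⟨(le_max_left _ _).trans_lt hx, hxa⟩⟩

/-- A linear upper bound for `q_c` at the critical point bounds the crossover exponent. -/
lemma one_le_of_isCrossoverExponent {d s : ℕ} (hpc : 0 < pc d) {C ε ψ : ℝ} (hC : 0 < C)
    (hε : 0 < ε) (h : ∀ p : unitInterval, 0 < pc d - (p : ℝ) → pc d - (p : ℝ) < ε →
      qc d s p ≤ C * (pc d - (p : ℝ))) (hψ : IsCrossoverExponent d s ψ) : 1 ≤ ψ := by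
  set F := comap (fun p : unitInterval => (p : ℝ)) (𝓝[<] (pc d)) with hF
  have : F.NeBot := neBot_comap_nhdsLT hpc (pc_le_one d)
  have hδ : Tendsto (fun p : unitInterval => pc d - (p : ℝ)) F (𝓝[>] 0) := by
    have h1 : Tendsto (fun x : ℝ => pc d - x) (𝓝[<] (pc d)) (𝓝[>] 0) := by
      refine tendsto_nhdsWithin_iff.2 ⟨?_, ?_⟩
      · have : Tendsto (fun x : ℝ => pc d - x) (𝓝 (pc d)) (𝓝 (pc d - pc d)) :=
          tendsto_const_nhds.sub tendsto_id
        rw [sub_self] at this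
        exact this.mono_left nhdsWithin_le_nhds
      · filter_upwards [self_mem_nhdsWithin] with x (hx : x < pc d)
        exact sub_pos.2 hx
    exact h1.comp tendsto_comap
  have hlog : Tendsto (fun p : unitInterval => Real.log (pc d - (p : ℝ))) F atBot :=
    Real.tendsto_log_nhdsGT_zero.comp hδ
  have hright : Tendsto (fun p : unitInterval => Real.log C / Real.log (pc d - (p : ℝ)) + 1) F
      (𝓝 (0 + 1)) := (tendsto_const_nhds.div_atBot hlog).add tendsto_const_nhds
  unfold IsCrossoverExponent at hψ
  have hleft := hψ.const_mul ψ
  rw [zero_add] at hright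
  rw [mul_one] at hleft
  refine le_of_tendsto_of_tendsto hright hleft ?_
  filter_upwards [hδ.eventually (Ioo_mem_nhdsGT hε), hlog.eventually (eventually_lt_atBot 0),
    hψ.eventually (lt_mem_nhds zero_lt_one)] with p hp hneg hpos
  obtain ⟨hp0, hpε⟩ := hp
  rw [abs_sub_comm, abs_of_pos hp0, Real.log_rpow hp0] at hpos ⊢
  -- The ratio is nonzero near the critical point, which excludes the junk values of `log` and `/`.
  have hne := (div_ne_zero_iff.1 hpos.ne').1
  have hψ0 : ψ ≠ 0 := left_ne_zero_of_mul (div_ne_zero_iff.1 hpos.ne').2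
  have hqc : 0 < qc d s p := lt_of_le_of_ne (qc_nonneg d s p) fun h0 => hne (by rw [← h0]; simp)
  have hle := Real.log_le_log hqc (h p hp0 hpε)
  rw [Real.log_mul hC.ne' hp0.ne'] at hle
  have h1 : ψ * (Real.log (qc d s p) / (ψ * Real.log (pc d - (p : ℝ)))) =
      Real.log (qc d s p) / Real.log (pc d - (p : ℝ)) := by
    field_simp
  rw [h1, div_add_one hneg.ne]
  exact div_le_div_of_nonpos_of_le hneg.le hle

end Main

end Percolation

theorem theorem1 (d : ℕ) (hd : 1 ≤ d) :
    (∃ ε : ℝ, 0 < ε ∧ ∀ s : ℕ, 1 ≤ s → ∀ p : unitInterval,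
      0 < Percolation.pc d - (p : ℝ) → Percolation.pc d - (p : ℝ) < ε →
        (∀ q : unitInterval, 8 * (d : ℝ) ^ 2 * (Percolation.pc d - (p : ℝ)) ≤ (q : ℝ) →
          ∀ᵐ ω ∂(Percolation.anisoMeasure d s p q),
            ∃ x : (Fin d → ℤ) × (Fin s → ℤ), (Percolation.cluster ω x).Infinite) ∧
        Percolation.qc d s p ≤ 8 * (d : ℝ) ^ 2 * (Percolation.pc d - (p : ℝ))) ∧
    (∀ s : ℕ, 1 ≤ s → ∀ ψ : ℝ, Percolation.IsCrossoverExponent d s ψ → 1 ≤ ψ) := by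
  obtain ⟨ε, hε, h⟩ := Percolation.exists_forall_ae_exists_infinite d hd
  have hqc : ∀ s : ℕ, 1 ≤ s → ∀ p : unitInterval, 0 < Percolation.pc d - (p : ℝ) →
      Percolation.pc d - (p : ℝ) < ε →
      Percolation.qc d s p ≤ 8 * (d : ℝ) ^ 2 * (Percolation.pc d - (p : ℝ)) := by
    intro s hs p hp hpε
    refine Real.sSup_le ?_ (by positivity)
    rintro _ ⟨q, rfl, hq⟩
    by_contra! hlt
    exact Percolation.anisoTheta_ne_zero_of_ae (h s hs p hp hpε q hlt.le) hq
  have hdpos : (0 : ℝ) < d := by exact_mod_cast hd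
  have hpc : 0 < Percolation.pc d := by
    refine lt_of_lt_of_le (inv_pos.2 ?_) (Percolation.inv_le_pc hd)
    exact_mod_cast (by omega : 0 < 2 * d - 1)
  exact ⟨⟨ε, hε, fun s hs p hp hpε => ⟨h s hs p hp hpε, hqc s hs p hp hpε⟩⟩, fun s hs ψ hψ =>
    Percolation.one_le_of_isCrossoverExponent hpc (by positivity) hε (hqc s hs) hψ⟩
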